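/- Let $k$ be a field and let $\mathbf A$, $\mathbf B$ be small dg-categories over $k$ (categories enriched in cochain complexes of $k$-vector spaces). Let $C_{dg}(\mathbf B)$ be the dg-category of right $\mathbf B$-dg-modules, i.e. of dg-functors $\mathbf B^{op}\to C_{dg}(k)$. An $\mathbf A$-$\mathbf B$-dg-bimodule is a dg-functor $T\colon \mathbf A\to C_{dg}(\mathbf B)$ (equivalently, a right $\mathbf B\otimes\mathbf A^{op}$-dg-module). The derived category $D(\mathbf B)$ (resp. $D(\mathbf B\otimes \mathbf A^{op})$) is the localization of the homotopy category $H^0$ of the dg-category of right $\mathbf B$-dg-modules (resp. of $\mathbf A$-$\mathbf B$-dg-bimodules) at the objectwise quasi-isomorphisms. Identify $H^0(\mathrm{RHom}(\mathbf A,\mathbf B))$, the category of quasi-functors from $\mathbf A$ to $\mathbf B$, with the full subcategory of $D(\mathbf B\otimes\mathbf A^{op})$ whose objects are the right quasi-representable bimodules: those $T$ such that for every $A\in\mathbf A$ there is an object $F(A)\in\mathbf B$ with $T(A)\cong \mathbf B(-,F(A))$ in $D(\mathbf B)$. For such a $T$, the objectwise zeroth cohomology $A\mapsto H^0(T(A)(-))$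 is a functor from $H^0(\mathbf A)$ to the presheaves of $k$-vector spaces on $H^0(\mathbf B)$ with representable values $H^0(T(A)(-))\cong H^0(\mathbf B)(-,F(A))$. By the Yoneda embedding of $H^0(\mathbf B)$ it therefore yields a $k$-linear functor $H^0(T)\colon H^0(\mathbf A)\to H^0(\mathbf B)$, and taking zeroth cohomology of morphisms gives a functor $$H^0\colon H^0(\mathrm{RHom}(\mathbf A,\mathbf B))\longrightarrow \mathrm{Fun}(H^0(\mathbf A),H^0(\mathbf B)),$$ where $\mathrm{Fun}$ denotes the category of $k$-linear functors and natural transformations. **Proposition.** This functor reflects isomorphisms: if $\varphi\colon T\to T'$ is a morphism of quasi-functors such that $H^0(\varphi)\colon H^0(T)\to H^0(T')$ is a natural isomorphism, then $\varphi$ is an isomorphism in $H^0(\mathrm{RHom}(\mathbf A,\mathbf B))$. -/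

import Mathlib

open CategoryTheory

universe w v u u₁ v₁ u₂ v₂ u₃ v₃

namespace DG

noncomputable section

section Cohomology

variable {k : Type w} [CommRing k]

/-- The `n`-cocycles of a cochain complex of `k`-modules. -/
def cocycles (C : CochainComplex (ModuleCat.{v} k) ℤ) (n : ℤ) : Submodule k (C.X n) :=
  LinearMap.ker (C.d n (n + 1)).hom

/-- The `n`-coboundaries, as a submodule of the `n`-cocycles. -/
def coboundaries (C : CochainComplex (ModuleCat.{v} k) ℤ) (n : ℤ) :
    Submodule k (cocycles C n) :=
  (LinearMap.range (C.d (n - 1) n).hom).comap (cocycles C n).subtype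

/-- The `n`-th cohomology `ker dⁿ / im dⁿ⁻¹`. -/
def Coh (C : CochainComplex (ModuleCat.{v} k) ℤ) (n : ℤ) : Type v :=
  cocycles C n ⧸ coboundaries C n

instance (C : CochainComplex (ModuleCat.{v} k) ℤ) (n : ℤ) :
    AddCommGroup (Coh C n) :=
  inferInstanceAs (AddCommGroup (cocycles C n ⧸ coboundaries C n))

instance (C : CochainComplex (ModuleCat.{v} k) ℤ) (n : ℤ) : Module k (Coh C n) :=
  inferInstanceAs (Module k (cocycles C n ⧸ coboundaries C n))

/-- The class of a cocycle. -/
def cls (C : CochainComplex (ModuleCat.{v} k) ℤ) (n : ℤ) : cocycles C n →ₗ[k] Coh C n :=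
  (coboundaries C n).mkQ

variable {C D : CochainComplex (ModuleCat.{v} k) ℤ}
  {C' : CochainComplex (ModuleCat.{v₁} k) ℤ}

lemma mem_cocycles {n m : ℤ} (h : n + 1 = m) (x : C.X n) :
    x ∈ cocycles C n ↔ C.d n m x = 0 := by
  subst h; rfl

lemma d_cocycle {n m : ℤ} (h : n + 1 = m) (x : cocycles C n) : C.d n m x.1 = 0 :=
  (mem_cocycles h x.1).1 x.2

lemma mem_coboundaries {n l : ℤ} (h : l + 1 = n) (x : cocycles C n) :
    x ∈ coboundaries C n ↔ ∃ y : C.X l, C.d l n y = x.1 := by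
  obtain rfl : l = n - 1 := by omega
  rfl

lemma cls_surjective {n : ℤ} (x : Coh C n) : ∃ y : cocycles C n, cls C n y = x :=
  Submodule.mkQ_surjective _ x

lemma cls_eq_zero {n l : ℤ} (h : l + 1 = n) (x : cocycles C n) :
    cls C n x = 0 ↔ ∃ y : C.X l, C.d l n y = x.1 := by
  rw [← mem_coboundaries h]
  exact Submodule.Quotient.mk_eq_zero _

/-- Descent of a linear map on cocycles to cohomology. -/
def Coh.lift {M : Type*} [AddCommGroup M] [Module k M] {n l : ℤ} (h : l + 1 = n)
    (f : cocycles C n →ₗ[k] M)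
    (hf : ∀ (y : C.X l) (x : cocycles C n), C.d l n y = x.1 → f x = 0) : Coh C n →ₗ[k] M :=
  (coboundaries C n).liftQ f (fun x hx => by
    rw [mem_coboundaries h] at hx
    obtain ⟨y, hy⟩ := hx
    exact hf y x hy)

lemma Coh.lift_cls {M : Type*} [AddCommGroup M] [Module k M] {n l : ℤ} (h : l + 1 = n)
    (f : cocycles C n →ₗ[k] M)
    (hf : ∀ (y : C.X l) (x : cocycles C n), C.d l n y = x.1 → f x = 0) (x : cocycles C n) :
    Coh.lift h f hf (cls C n x) = f x := rfl

/-- Descent of a bilinear map on cocycles to cohomology. -/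
def Coh.lift₂ {M : Type*} [AddCommGroup M] [Module k M] {n l n' l' : ℤ} (h : l + 1 = n)
    (h' : l' + 1 = n') (f : cocycles C n →ₗ[k] cocycles C' n' →ₗ[k] M)
    (hf : ∀ (y : C.X l) (x : cocycles C n) (z : cocycles C' n'), C.d l n y = x.1 → f x z = 0)
    (hf' : ∀ (z : cocycles C n) (y : C'.X l') (x : cocycles C' n'),
      C'.d l' n' y = x.1 → f z x = 0) :
    Coh C n →ₗ[k] Coh C' n' →ₗ[k] M :=
  Coh.lift h
    { toFun := fun z => Coh.lift h' (f z) (hf' z)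
      map_add' := fun z z' => by
        refine LinearMap.ext fun x => ?_
        obtain ⟨x, rfl⟩ := cls_surjective x
        simp only [Coh.lift_cls, map_add, LinearMap.add_apply]
      map_smul' := fun r z => by
        refine LinearMap.ext fun x => ?_
        obtain ⟨x, rfl⟩ := cls_surjective x
        simp only [Coh.lift_cls, map_smul, LinearMap.smul_apply, RingHom.id_apply] }
    (fun y z hy => by
      refine LinearMap.ext fun x => ?_
      obtain ⟨x, rfl⟩ := cls_surjective x
      exact hf y z x hy)

end Cohomology

set_option linter.checkUnivs false in
/-- A differential graded category over `k`. Composition is written in diagrammatic order: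
`comp h f g` is the composite `g ∘ f` of `f` of degree `p` and `g` of degree `q`. The
axiom `d_comp` then reads `d (g ∘ f) = dg ∘ f + (-1)^|g| g ∘ df`, and says that composition
is a chain map `A(Y, Z) ⊗ A(X, Y) ⟶ A(X, Z)`. -/
structure DGCat (k : Type w) [CommRing k] where
  /-- The objects. -/
  Obj : Type u
  /-- The complexes of morphisms. -/
  Hom : Obj → Obj → CochainComplex (ModuleCat.{v} k) ℤ
  /-- The identities. -/
  id : ∀ X, (Hom X X).X 0
  /-- The composition. -/
  comp : ∀ {X Y Z : Obj} {p q n : ℤ} (_ : p + q = n),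
    (Hom X Y).X p →ₗ[k] (Hom Y Z).X q →ₗ[k] (Hom X Z).X n
  d_id : ∀ X, (Hom X X).d 0 1 (id X) = 0
  d_comp : ∀ {X Y Z : Obj} {p q n p' q' n' : ℤ} (h : p + q = n) (hp : p + 1 = p')
    (hq : q + 1 = q') (hn : n + 1 = n') (f : (Hom X Y).X p) (g : (Hom Y Z).X q),
    (Hom X Z).d n n' (comp h f g) =
      comp (by omega : p + q' = n') f ((Hom Y Z).d q q' g) +
        q.negOnePow • comp (by omega : p' + q = n') ((Hom X Y).d p p' f) g
  id_comp : ∀ {X Y : Obj} {n : ℤ} (f : (Hom X Y).X n), comp (zero_add n) (id X) f = f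
  comp_id : ∀ {X Y : Obj} {n : ℤ} (f : (Hom X Y).X n), comp (add_zero n) f (id Y) = f
  assoc : ∀ {X Y Z W : Obj} {p q r a b n : ℤ} (h₁ : p + q = a) (h₂ : q + r = b)
    (h₃ : a + r = n) (h₄ : p + b = n)
    (f : (Hom X Y).X p) (g : (Hom Y Z).X q) (h : (Hom Z W).X r),
    comp h₃ (comp h₁ f g) h = comp h₄ f (comp h₂ g h)

variable {k : Type w} [CommRing k]

/-- A dg-functor: a map on objects together with `k`-linear chain maps on the complexes of
morphisms, compatible with identities and composition. -/
structure DGFun (A : DGCat.{w, v₁, u₁} k) (B : DGCat.{w, v₂, u₂} k) where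
  /-- The action on objects. -/
  obj : A.Obj → B.Obj
  /-- The action on morphisms of degree `n`. -/
  map : ∀ {X Y : A.Obj} (n : ℤ), (A.Hom X Y).X n →ₗ[k] (B.Hom (obj X) (obj Y)).X n
  map_d : ∀ {X Y : A.Obj} {n m : ℤ} (_ : n + 1 = m) (f : (A.Hom X Y).X n),
    map m ((A.Hom X Y).d n m f) = (B.Hom (obj X) (obj Y)).d n m (map n f)
  map_id : ∀ X, map 0 (A.id X) = B.id (obj X)
  map_comp : ∀ {X Y Z : A.Obj} {p q n : ℤ} (h : p + q = n) (f : (A.Hom X Y).X p)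
    (g : (A.Hom Y Z).X q), map n (A.comp h f g) = B.comp h (map p f) (map q g)

/-- The opposite dg-category: `A.op(X, Y) = A(Y, X)`, with composition
`fᵒᵖ ∘ gᵒᵖ = (-1)^(|f||g|) (g ∘ f)ᵒᵖ`. -/
def DGCat.op (A : DGCat.{w, v, u} k) : DGCat.{w, v, u} k where
  Obj := A.Obj
  Hom X Y := A.Hom Y X
  id := A.id
  comp {X Y Z p q n} h := (p * q).negOnePow • (A.comp (by omega : q + p = n)).flip
  d_id := A.d_id
  d_comp {X Y Z p q n p' q' n'} h hp hq hn f g := by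
    subst hp hq
    simp only [LinearMap.smul_apply, LinearMap.flip_apply, LinearMap.map_smul_of_tower]
    rw [A.d_comp (by omega) rfl rfl (by omega)]
    simp only [smul_add, smul_smul, ← Int.negOnePow_add]
    rw [add_comm]
    congr 2
    · congr 1; ring
    · rw [Int.negOnePow_eq_iff]; ring_nf; simp
  id_comp f := by simp [A.comp_id]
  comp_id f := by simp [A.id_comp]
  assoc {X Y Z W p q r a b n} h₁ h₂ h₃ h₄ f g h := by
    subst h₁ h₂
    simp only [LinearMap.smul_apply, LinearMap.flip_apply, LinearMap.map_smul_of_tower, smul_smul,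
      ← Int.negOnePow_add]
    rw [← A.assoc (a := q + r) (b := p + q) (n := n) (by omega) (by omega) (by omega) (by omega)]
    congr 2; ring

section Complexes

open CochainComplex.HomComplex

/-- The dg-category of complexes of `k`-modules. The complex of morphisms from `V` to `W` is
`∏ᵢ Hom(Vⁱ, Wⁱ⁺ⁿ)` in degree `n`, with differential `df = d_W ∘ f - (-1)^|f| f ∘ d_V`. -/
def CdgK (k : Type w) [CommRing k] : DGCat.{w, v, max (v + 1) w} k where
  Obj := CochainComplex (ModuleCat.{v} k) ℤ
  Hom V W :=
    { X := fun n => ModuleCat.of k (Cochain V W n)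
      d := fun n m => ModuleCat.ofHom (δ_hom k V W n m)
      shape := fun n m h => by
        refine ModuleCat.hom_ext (LinearMap.ext fun x => ?_)
        exact δ_shape n m h x
      d_comp_d' := fun n m l _ _ => by
        refine ModuleCat.hom_ext (LinearMap.ext fun x => ?_)
        exact δ_δ n m l x }
  id V := Cochain.ofHom (𝟙 V)
  comp {X Y Z p q n} h := LinearMap.mk₂ k (fun f g => Cochain.comp f g h)
    (fun _ _ _ => Cochain.add_comp _ _ _ _) (fun _ _ _ => Cochain.smul_comp _ _ _ _)
    (fun _ _ _ => Cochain.comp_add _ _ _ _) (fun _ _ _ => Cochain.comp_smul _ _ _ _)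
  d_id V := δ_ofHom (𝟙 V)
  d_comp {X Y Z p q n p' q' n'} h hp hq hn f g := δ_comp f g h p' q' n' hn hp hq
  id_comp f := Cochain.id_comp f
  comp_id f := Cochain.comp_id f
  assoc {X Y Z W p q r a b n} h₁ h₂ h₃ h₄ f g h :=
    Cochain.comp_assoc f g h h₁ h₂ (by omega)

end Complexes

section FunDG

variable {A : DGCat.{w, v₁, u₁} k} {B : DGCat.{w, v₂, u₂} k}

/-- The dg-natural transformations `F ⟶ G` of degree `p`: families of morphisms
`φ_X : F(X) ⟶ G(X)` of degree `p` with `G(f) ∘ φ_X = (-1)^(p|f|) φ_Y ∘ F(f)`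
for all `f : X ⟶ Y`. -/
def dgNatTrans (F G : DGFun A B) (p : ℤ) :
    Submodule k (∀ X, (B.Hom (F.obj X) (G.obj X)).X p) where
  carrier := {φ | ∀ {X Y : A.Obj} {q n : ℤ} (h : p + q = n) (h' : q + p = n)
    (f : (A.Hom X Y).X q), B.comp h (φ X) (G.map q f) =
      (p * q).negOnePow • B.comp h' (F.map q f) (φ Y)}
  zero_mem' := by simp
  add_mem' := by
    intro a b ha hb X Y q n h h' f
    simp only [Pi.add_apply, map_add, LinearMap.add_apply, smul_add]
    rw [ha h h' f, hb h h' f]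
  smul_mem' := by
    intro c a ha X Y q n h h' f
    simp only [Pi.smul_apply, map_smul, LinearMap.smul_apply]
    rw [ha h h' f, smul_comm]

/-- The objectwise differential of dg-natural transformations. -/
def dgNatTransD (F G : DGFun A B) (p p' : ℤ) : dgNatTrans F G p →ₗ[k] dgNatTrans F G p' :=
  (LinearMap.pi fun X => (((B.Hom (F.obj X) (G.obj X)).d p p').hom ∘ₗ
    LinearMap.proj X)).restrict (by
      intro φ hφ X Y q n h h' f
      by_cases hp : p + 1 = p'
      · subst hp
        have key := congrArg ((B.Hom (F.obj X) (G.obj Y)).d (p + q) n)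
          (hφ (X := X) (Y := Y) rfl (add_comm q p) f)
        have e := hφ (X := X) (Y := Y) (q := q + 1) (n := n) (by omega) (by omega)
          ((A.Hom X Y).d q (q + 1) f)
        rw [B.d_comp rfl rfl rfl (by omega)] at key
        erw [LinearMap.map_smul_of_tower] at key
        rw [B.d_comp (by omega) rfl rfl (by omega)] at key
        rw [← G.map_d rfl, ← F.map_d rfl, e, smul_add, add_comm, smul_smul,
          ← Int.negOnePow_add] at key
        have e2 : p * q + p = p * (q + 1) := by ring
        rw [e2, add_right_cancel_iff] at key
        have key' := congrArg (q.negOnePow • ·) key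
        simp only [smul_smul, ← Int.negOnePow_add] at key'
        rw [Int.negOnePow_even (q + q) ⟨q, rfl⟩, one_smul] at key'
        have e3 : (p + 1) * q = q + p * q := by ring
        rw [e3]
        exact key'
      · simp [(B.Hom _ _).shape p p' hp])


/-- The identity dg-natural transformation. -/
def dgNatTransId (F : DGFun A B) : dgNatTrans F F 0 :=
  ⟨fun X => B.id (F.obj X), fun {X Y q n} h h' f => by
    obtain rfl : q = n := by omega
    rw [B.id_comp, B.comp_id, zero_mul, Int.negOnePow_zero, one_smul]⟩

/-- The objectwise composition of dg-natural transformations. -/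
def dgNatTransComp (F G H : DGFun A B) {p q n : ℤ} (h : p + q = n) :
    dgNatTrans F G p →ₗ[k] dgNatTrans G H q →ₗ[k] dgNatTrans F H n :=
  LinearMap.mk₂ k
    (fun φ ψ => ⟨fun X => B.comp h (φ.1 X) (ψ.1 X), fun {X Y r m} h₁ h₂ f => by
      have e1 := ψ.2 (X := X) (Y := Y) rfl (add_comm r q) f
      have e2 := φ.2 (X := X) (Y := Y) rfl (add_comm r p) f
      rw [B.assoc h rfl h₁ (by omega), e1, LinearMap.map_smul_of_tower,
        ← B.assoc rfl _ (by omega : p + r + q = m) _, e2, LinearMap.map_smul_of_tower,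
        LinearMap.smul_apply, smul_smul, ← Int.negOnePow_add,
        B.assoc _ h _ h₂]
      congr 2
      subst h
      ring⟩)
    (fun a b c => Subtype.ext (funext fun X => LinearMap.map_add₂ _ (a.1 X) (b.1 X) (c.1 X)))
    (fun r a c => Subtype.ext (funext fun X => LinearMap.map_smul₂ _ r (a.1 X) (c.1 X)))
    (fun a b c => Subtype.ext (funext fun X => map_add _ (b.1 X) (c.1 X)))
    (fun r a c => Subtype.ext (funext fun X => map_smul _ r (c.1 X)))

variable (A B) in
/-- The dg-category of dg-functors from `A` to `B`: the morphisms are the dg-natural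
transformations, with objectwise differential and composition. -/
def FunDG : DGCat.{w, max u₁ v₂, max u₁ u₂ v₁ v₂} k where
  Obj := DGFun A B
  Hom F G :=
    { X := fun p => ModuleCat.of k (dgNatTrans F G p)
      d := fun p p' => ModuleCat.ofHom (dgNatTransD F G p p')
      shape := fun p p' h => by
        refine ModuleCat.hom_ext (LinearMap.ext fun φ => Subtype.ext (funext fun X => ?_))
        change (B.Hom (F.obj X) (G.obj X)).d p p' (φ.1 X) = 0
        rw [(B.Hom (F.obj X) (G.obj X)).shape p p' h]
        rfl
      d_comp_d' := fun p p' p'' _ _ => by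
        refine ModuleCat.hom_ext (LinearMap.ext fun φ => Subtype.ext (funext fun X => ?_))
        exact ConcreteCategory.congr_hom
          ((B.Hom (F.obj X) (G.obj X)).d_comp_d p p' p'') (φ.1 X) }
  id F := dgNatTransId F
  comp {F G H p q n} h := dgNatTransComp F G H h
  d_id F := Subtype.ext (funext fun X => B.d_id (F.obj X))
  d_comp h hp hq hn φ ψ := Subtype.ext (funext fun X =>
    B.d_comp h hp hq hn (φ.1 X) (ψ.1 X))
  id_comp φ := Subtype.ext (funext fun X => B.id_comp (φ.1 X))
  comp_id φ := Subtype.ext (funext fun X => B.comp_id (φ.1 X))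
  assoc h₁ h₂ h₃ h₄ φ ψ χ := Subtype.ext (funext fun X =>
    B.assoc h₁ h₂ h₃ h₄ (φ.1 X) (ψ.1 X) (χ.1 X))

end FunDG

section H0

/-- Composition of cocycles of degree zero. -/
def cocyclesComp (A : DGCat.{w, v, u} k) (X Y Z : A.Obj) :
    cocycles (A.Hom X Y) 0 →ₗ[k] cocycles (A.Hom Y Z) 0 →ₗ[k] cocycles (A.Hom X Z) 0 :=
  LinearMap.mk₂ k
    (fun f g => ⟨A.comp (add_zero 0) f.1 g.1, by
      have hf := (mem_cocycles (zero_add 1) _).1 f.2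
      have hg := (mem_cocycles (zero_add 1) _).1 g.2
      rw [mem_cocycles (zero_add 1), A.d_comp _ (zero_add 1) (zero_add 1) (zero_add 1), hf, hg]
      simp⟩)
    (fun a b c => Subtype.ext (LinearMap.map_add₂ _ a.1 b.1 c.1))
    (fun r a c => Subtype.ext (LinearMap.map_smul₂ _ r a.1 c.1))
    (fun a b c => Subtype.ext (map_add _ b.1 c.1))
    (fun r a c => Subtype.ext (map_smul _ r c.1))

/-- Composition of cohomology classes of degree zero. -/
def cohComp (A : DGCat.{w, v, u} k) (X Y Z : A.Obj) :
    Coh (A.Hom X Y) 0 →ₗ[k] Coh (A.Hom Y Z) 0 →ₗ[k] Coh (A.Hom X Z) 0 :=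
  Coh.lift₂ (neg_add_cancel 1) (neg_add_cancel 1)
    ((cocyclesComp A X Y Z).compr₂ (cls (A.Hom X Z) 0))
    (fun y f g hy => by
      refine (cls_eq_zero (neg_add_cancel 1) _).2 ⟨A.comp (add_zero (-1)) y g.1, ?_⟩
      rw [A.d_comp _ (neg_add_cancel 1) (zero_add 1) (neg_add_cancel 1), hy,
        d_cocycle (zero_add 1)]
      simp [cocyclesComp])
    (fun f y g hy => by
      refine (cls_eq_zero (neg_add_cancel 1) _).2 ⟨A.comp (zero_add (-1)) f.1 y, ?_⟩
      rw [A.d_comp _ (zero_add 1) (neg_add_cancel 1) (neg_add_cancel 1), hy,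
        d_cocycle (zero_add 1)]
      simp [cocyclesComp])

/-- The homotopy category `H⁰(A)` of a dg-category: same objects, and the morphisms from
`X` to `Y` are the classes in `H⁰(A(X, Y))`. -/
structure H0 (A : DGCat.{w, v, u} k) where
  /-- The underlying object of the dg-category. -/
  as : A.Obj

instance (A : DGCat.{w, v, u} k) : Category.{v} (H0 A) where
  Hom X Y := Coh (A.Hom X.as Y.as) 0
  id X := cls _ _ ⟨A.id X.as, (mem_cocycles (zero_add 1) _).2 (A.d_id X.as)⟩
  comp f g := cohComp A _ _ _ f g
  id_comp f := by
    obtain ⟨f, rfl⟩ := cls_surjective f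
    exact congrArg (cls _ _) (Subtype.ext (A.id_comp f.1))
  comp_id f := by
    obtain ⟨f, rfl⟩ := cls_surjective f
    exact congrArg (cls _ _) (Subtype.ext (A.comp_id f.1))
  assoc f g h := by
    obtain ⟨f, rfl⟩ := cls_surjective f
    obtain ⟨g, rfl⟩ := cls_surjective g
    obtain ⟨h, rfl⟩ := cls_surjective h
    exact congrArg (cls _ _) (Subtype.ext (A.assoc _ _ _ _ f.1 g.1 h.1))

instance (A : DGCat.{w, v, u} k) : Preadditive (H0 A) where
  homGroup X Y := inferInstanceAs (AddCommGroup (Coh (A.Hom X.as Y.as) 0))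
  add_comp X Y Z f f' g := LinearMap.map_add₂ (cohComp A X.as Y.as Z.as) f f' g
  comp_add X Y Z f g g' := (cohComp A X.as Y.as Z.as f).map_add g g'

instance (A : DGCat.{w, v, u} k) : Linear k (H0 A) where
  homModule X Y := inferInstanceAs (Module k (Coh (A.Hom X.as Y.as) 0))
  smul_comp X Y Z r f g := LinearMap.map_smul₂ (cohComp A X.as Y.as Z.as) r f g
  comp_smul X Y Z f r g := (cohComp A X.as Y.as Z.as f).map_smul r g

variable {A : DGCat.{w, v₁, u₁} k} {B : DGCat.{w, v₂, u₂} k}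

/-- The action of a dg-functor on closed morphisms of degree zero. -/
def DGFun.cocyclesMap (F : DGFun A B) (X Y : A.Obj) :
    cocycles (A.Hom X Y) 0 →ₗ[k] cocycles (B.Hom (F.obj X) (F.obj Y)) 0 :=
  (F.map 0).restrict (fun f hf => by
    rw [mem_cocycles (zero_add 1)] at hf ⊢
    rw [← F.map_d (zero_add 1), hf, map_zero])

/-- The action of a dg-functor on cohomology classes of degree zero. -/
def DGFun.cohMap (F : DGFun A B) (X Y : A.Obj) :
    Coh (A.Hom X Y) 0 →ₗ[k] Coh (B.Hom (F.obj X) (F.obj Y)) 0 :=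
  Coh.lift (neg_add_cancel 1) (cls _ 0 ∘ₗ F.cocyclesMap X Y) (fun y f hy => by
    refine (cls_eq_zero (neg_add_cancel 1) _).2 ⟨F.map _ y, ?_⟩
    rw [← F.map_d (neg_add_cancel 1), hy]
    rfl)

/-- The functor `H⁰(F) : H⁰(A) ⥤ H⁰(B)` induced by a dg-functor `F`. -/
def DGFun.H0 (F : DGFun A B) : H0 A ⥤ H0 B where
  obj X := ⟨F.obj X.as⟩
  map {X Y} f := F.cohMap X.as Y.as f
  map_id X := congrArg (cls _ _) (Subtype.ext (F.map_id X.as))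
  map_comp f g := by
    obtain ⟨f, rfl⟩ := cls_surjective f
    obtain ⟨g, rfl⟩ := cls_surjective g
    exact congrArg (cls _ _) (Subtype.ext (F.map_comp _ f.1 g.1))

instance (F : DGFun A B) : F.H0.Additive where
  map_add {X Y f g} := map_add (F.cohMap X.as Y.as) f g

instance (F : DGFun A B) : F.H0.Linear k where
  map_smul {X Y} f r := map_smul (F.cohMap X.as Y.as) r f

variable (A B) in
/-- Evaluation at an object `X`, as a dg-functor on the dg-category of dg-functors. -/
def evDG (X : A.Obj) : DGFun (FunDG A B) B where
  obj F := F.obj X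
  map {F G} p := LinearMap.proj X ∘ₗ (dgNatTrans F G p).subtype
  map_d _ _ := rfl
  map_id _ := rfl
  map_comp _ _ _ := rfl

variable (A B) in
/-- The functor sending a dg-functor `F` to `H⁰(F)`, and the class of a closed dg-natural
transformation `φ` of degree zero to the natural transformation with components `[φ_X]`. -/
def H0Fun : H0 (FunDG A B) ⥤ (H0 A ⥤ H0 B) where
  obj F := F.as.H0
  map {F G} φ :=
    { app := fun X => (evDG A B X.as).H0.map φ
      naturality := fun X Y f => by
        obtain ⟨φ, rfl⟩ := cls_surjective φ
        obtain ⟨f, rfl⟩ := cls_surjective f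
        refine congrArg (cls _ _) (Subtype.ext ?_)
        have := φ.1.2 (X := X.as) (Y := Y.as) (add_zero 0) (add_zero 0) f.1
        rw [zero_mul, Int.negOnePow_zero, one_smul] at this
        exact this.symm }
  map_id F := by
    ext X
    exact (evDG A B X.as).H0.map_id F
  map_comp φ ψ := by
    ext X
    exact (evDG A B X.as).H0.map_comp φ ψ

/-- The identification of `H⁰(B)ᵒᵖ` with `H⁰(Bᵒᵖ)`. -/
def opH0 (B : DGCat.{w, v, u} k) : (H0 B)ᵒᵖ ⥤ H0 B.op where
  obj X := ⟨X.unop.as⟩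
  map f := f.unop
  map_id _ := rfl
  map_comp f g := by
    obtain ⟨f', hf⟩ := cls_surjective f.unop
    obtain ⟨g', hg⟩ := cls_surjective g.unop
    obtain rfl : f = Quiver.Hom.op (cls _ _ f') := by rw [hf]; rfl
    obtain rfl : g = Quiver.Hom.op (cls _ _ g') := by rw [hg]; rfl
    refine congrArg (cls _ _) (Subtype.ext ?_)
    change _ = (((0 : ℤ) * 0).negOnePow • (B.comp _).flip) f'.1 g'.1
    rw [zero_mul, Int.negOnePow_zero, one_smul]
    rfl

end H0

section Coh

open CochainComplex.HomComplex

/-- The chain map given by a closed morphism of degree zero in the dg-category of complexes. -/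
def toChainMap {V W : CochainComplex (ModuleCat.{v} k) ℤ} (φ : cocycles ((CdgK k).Hom V W) 0) :
    V ⟶ W :=
  Cocycle.homOf (Cocycle.mk φ.1 1 (zero_add 1) ((mem_cocycles (zero_add 1) _).1 φ.2))

lemma toChainMap_f {V W : CochainComplex (ModuleCat.{v} k) ℤ}
    (φ : cocycles ((CdgK k).Hom V W) 0) (n : ℤ) :
    (toChainMap φ).f n = Cochain.v (F := V) (G := W) φ.1 n n (add_zero n) := rfl

/-- The action of closed morphisms of degree zero in the dg-category of complexes on
cocycles. -/
def cocyclesAct (V W : CochainComplex (ModuleCat.{v} k) ℤ) (n : ℤ) :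
    cocycles ((CdgK k).Hom V W) 0 →ₗ[k] cocycles V n →ₗ[k] cocycles W n :=
  LinearMap.mk₂ k
    (fun φ x => ⟨(toChainMap φ).f n x.1, by
      rw [mem_cocycles rfl, ← ConcreteCategory.comp_apply, HomologicalComplex.Hom.comm,
        ConcreteCategory.comp_apply, d_cocycle rfl, map_zero]⟩)
    (fun _ _ _ => rfl) (fun _ _ _ => rfl)
    (fun φ x y => Subtype.ext (map_add ((toChainMap φ).f n).hom x.1 y.1))
    (fun r φ x => Subtype.ext (map_smul ((toChainMap φ).f n).hom r x.1))

/-- The map induced on `n`-th cohomology by the class of a closed morphism of degree zero in the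
dg-category of complexes. -/
def cohAct (V W : CochainComplex (ModuleCat.{v} k) ℤ) (n : ℤ) :
    Coh ((CdgK k).Hom V W) 0 →ₗ[k] Coh V n →ₗ[k] Coh W n :=
  Coh.lift₂ (neg_add_cancel 1) (sub_add_cancel n 1)
    ((cocyclesAct V W n).compr₂ (cls W n))
    (fun h φ x hh => by
      refine (cls_eq_zero (sub_add_cancel n 1) _).2
        ⟨(Cochain.v (F := V) (G := W) h n (n - 1) (by omega)) x.1, ?_⟩
      have e : φ.1 = δ (F := V) (G := W) (-1) 0 h := hh.symm
      change _ = (toChainMap φ).f n x.1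
      rw [toChainMap_f, e,
        δ_v (-1) 0 (by omega) h n n (by omega) (n - 1) (n + 1) (by omega) (by omega)]
      simp [d_cocycle rfl x])
    (fun φ y x hy => by
      refine (cls_eq_zero (sub_add_cancel n 1) _).2 ⟨(toChainMap φ).f _ y, ?_⟩
      change _ = (toChainMap φ).f n x.1
      rw [← ConcreteCategory.comp_apply, HomologicalComplex.Hom.comm,
        ConcreteCategory.comp_apply, hy])

lemma cohAct_id (V : CochainComplex (ModuleCat.{v} k) ℤ) (n : ℤ) :
    cohAct V V n (𝟙 (⟨V⟩ : H0 (CdgK k)) : _) = LinearMap.id := by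
  refine LinearMap.ext fun x => ?_
  obtain ⟨x, rfl⟩ := cls_surjective x
  refine congrArg (cls _ _) (Subtype.ext ?_)
  change (Cochain.ofHom (𝟙 V)).v n n (add_zero n) x.1 = x.1
  simp

lemma cohAct_comp (U V W : CochainComplex (ModuleCat.{v} k) ℤ) (n : ℤ)
    (φ : Coh ((CdgK k).Hom U V) 0) (ψ : Coh ((CdgK k).Hom V W) 0) :
    cohAct U W n (cohComp (CdgK k) U V W φ ψ) = cohAct V W n ψ ∘ₗ cohAct U V n φ := by
  obtain ⟨φ, rfl⟩ := cls_surjective φ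
  obtain ⟨ψ, rfl⟩ := cls_surjective ψ
  refine LinearMap.ext fun x => ?_
  obtain ⟨x, rfl⟩ := cls_surjective x
  refine congrArg (cls _ _) (Subtype.ext ?_)
  change (Cochain.comp (F := U) (G := V) (K := W) φ.1 ψ.1 (add_zero 0)).v n n (add_zero n) x.1 =
    Cochain.v (F := V) (G := W) ψ.1 n n (add_zero n)
      (Cochain.v (F := U) (G := V) φ.1 n n (add_zero n) x.1)
  exact ConcreteCategory.congr_hom (Cochain.comp_v (F := U) (G := V) (K := W) φ.1 ψ.1
    (add_zero 0) n n n (add_zero n) (add_zero n)) x.1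

/-- The complex underlying an object of the homotopy category of complexes. -/
def H0.cx (V : H0 (CdgK.{w, v} k)) : CochainComplex (ModuleCat.{v} k) ℤ := V.as

/-- The `n`-th cohomology functor on the homotopy category of complexes. -/
def cohFunctor (k : Type w) [CommRing k] (n : ℤ) : H0 (CdgK.{w, v} k) ⥤ ModuleCat.{v} k where
  obj V := ModuleCat.of k (Coh V.cx n)
  map {V W} φ := ModuleCat.ofHom (cohAct V.cx W.cx n φ)
  map_id V := ModuleCat.hom_ext (cohAct_id V.cx n)
  map_comp {U V W} φ ψ := ModuleCat.hom_ext (cohAct_comp U.cx V.cx W.cx n φ ψ)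

instance (n : ℤ) : (cohFunctor.{w, v} k n).Additive where
  map_add {V W φ ψ} := ModuleCat.hom_ext ((cohAct V.cx W.cx n).map_add φ ψ)

instance (n : ℤ) : (cohFunctor.{w, v} k n).Linear k where
  map_smul {V W} φ r := ModuleCat.hom_ext ((cohAct V.cx W.cx n).map_smul r φ)

end Coh

section Modules

open CochainComplex.HomComplex

/-- The dg-category of right `B`-dg-modules, i.e. of dg-functors from `Bᵒᵖ` to complexes. -/
def DGMod (B : DGCat.{w, v, u} k) : DGCat.{w, max u v, max u w (v + 1)} k :=
  FunDG B.op (CdgK.{w, v} k)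

/-- The homotopy category of right `B`-dg-modules. -/
abbrev HoMod (B : DGCat.{w, v, u} k) := H0 (DGMod B)

/-- The right action of the morphisms `f : Y ⟶ X` of `B` on the complexes `B(-, b)`, sending
`g : X ⟶ b` to `(-1)^(|f||g|) g ∘ f`. -/
def yonedaMap (B : DGCat.{w, v, u} k) (b : B.Obj) {X Y : B.Obj} (n : ℤ) :
    (B.Hom Y X).X n →ₗ[k] Cochain (B.Hom X b) (B.Hom Y b) n where
  toFun f := Cochain.mk fun p q h =>
    ModuleCat.ofHom ((n * p).negOnePow • B.comp (by omega : n + p = q) f)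
  map_add' f g := by
    ext p q h x
    simp
  map_smul' r f := by
    ext p q h x
    simp [smul_comm r]

lemma yonedaMap_d (B : DGCat.{w, v, u} k) (b : B.Obj) {X Y : B.Obj} (n : ℤ)
    (f : (B.Hom Y X).X n) :
    yonedaMap B b (n + 1) ((B.Hom Y X).d n (n + 1) f) =
      δ n (n + 1) (yonedaMap B b n f) := by
  refine Cochain.ext _ _ fun p q hpq => ?_
  refine ModuleCat.hom_ext (LinearMap.ext fun g => ?_)
  rw [δ_v n (n + 1) rfl _ p q hpq (p + n) (p + 1) (by omega) rfl]
  change ((n + 1) * p).negOnePow • B.comp _ ((B.Hom Y X).d n (n + 1) f) g =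
    (B.Hom Y b).d (p + n) q ((n * p).negOnePow • B.comp _ f g) +
      (n + 1).negOnePow • ((n * (p + 1)).negOnePow • B.comp _ f ((B.Hom X b).d p (p + 1) g))
  erw [LinearMap.map_smul_of_tower]
  rw [B.d_comp (by omega) rfl rfl (by omega), smul_add, smul_smul, smul_smul,
    ← Int.negOnePow_add, ← Int.negOnePow_add]
  have e1 : (n + 1) + n * (p + 1) = n * p + (n + n) + 1 := by ring
  have e2 : n * p + p = (n + 1) * p := by ring
  rw [e1, Int.negOnePow_succ, Int.negOnePow_add (n * p) (n + n),
    Int.negOnePow_even (n + n) ⟨n, rfl⟩, mul_one, e2]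
  simp only [Units.neg_smul]
  abel

lemma yonedaMap_id (B : DGCat.{w, v, u} k) (b : B.Obj) (X : B.Obj) :
    yonedaMap B b 0 (B.id X) = Cochain.ofHom (𝟙 (B.Hom X b)) := by
  refine Cochain.ext _ _ fun p q hpq => ?_
  obtain rfl : p = q := by omega
  refine ModuleCat.hom_ext (LinearMap.ext fun g => ?_)
  change ((0 : ℤ) * p).negOnePow • B.comp _ (B.id X) g = _
  rw [B.id_comp, zero_mul, Int.negOnePow_zero, one_smul, Cochain.ofHom_v]
  rfl

lemma yonedaMap_comp (B : DGCat.{w, v, u} k) (b : B.Obj) {X Y Z : B.Obj} {p q n : ℤ}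
    (h : p + q = n) (f : (B.Hom Y X).X p) (g : (B.Hom Z Y).X q) :
    yonedaMap B b n ((p * q).negOnePow • B.comp ((add_comm q p).trans h) g f) =
      Cochain.comp (yonedaMap B b p f) (yonedaMap B b q g) h := by
  refine Cochain.ext _ _ fun i j hij => ?_
  refine ModuleCat.hom_ext (LinearMap.ext fun x => ?_)
  rw [Cochain.comp_v _ _ h i (i + p) j rfl (by omega)]
  change (n * i).negOnePow • B.comp _ ((p * q).negOnePow • B.comp _ g f) x =
    (q * (i + p)).negOnePow • B.comp _ g ((p * i).negOnePow • B.comp _ f x)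
  subst h
  rw [LinearMap.map_smul_of_tower, LinearMap.map_smul_of_tower, LinearMap.smul_apply,
    smul_smul, smul_smul, ← Int.negOnePow_add, ← Int.negOnePow_add,
    B.assoc (b := i + p) _ (by omega) _ (by omega)]
  have e : (p + q) * i + p * q = q * (i + p) + p * i := by ring
  rw [e]

/-- The representable right dg-module `B(-, b)`; a morphism `f : Y ⟶ X` of `B` acts by
`g ↦ (-1)^(|f||g|) g ∘ f`. -/
def yonedaDG (B : DGCat.{w, v, u} k) (b : B.Obj) : DGFun B.op (CdgK.{w, v} k) where
  obj X := B.Hom X b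
  map n := yonedaMap B b n
  map_d {_ _ n _} h f := by
    subst h
    exact yonedaMap_d B b n f
  map_id X := yonedaMap_id B b X
  map_comp h f g := yonedaMap_comp B b h f g

/-- The functor sending a right `B`-dg-module `M` to its objectwise zeroth cohomology
`b ↦ H⁰(M(b))`, a presheaf of `k`-modules on `H⁰(B)`. -/
def modH0 (B : DGCat.{w, v, u} k) : HoMod B ⥤ ((H0 B)ᵒᵖ ⥤ ModuleCat.{v} k) :=
  H0Fun B.op (CdgK k) ⋙ (Functor.whiskeringLeft _ _ _).obj (opH0 B) ⋙
    (Functor.whiskeringRight _ _ _).obj (cohFunctor k 0)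

/-- The zeroth cohomology of `B(-, b)` is the presheaf `H⁰(B)(-, b)`. -/
def modH0Yoneda (B : DGCat.{w, v, u} k) (b : B.Obj) :
    (modH0 B).obj ⟨yonedaDG B b⟩ ≅ (linearYoneda k (H0 B)).obj ⟨b⟩ :=
  NatIso.ofComponents (fun c => Iso.refl (ModuleCat.of k (Coh (B.Hom c.unop.as b) 0))) (by
    intro c c' f
    obtain ⟨f', hf⟩ := cls_surjective f.unop
    obtain rfl : f = Quiver.Hom.op (cls _ _ f') := by rw [hf]; rfl
    refine ModuleCat.hom_ext (LinearMap.ext fun x => ?_)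
    obtain ⟨x, rfl⟩ := cls_surjective x
    refine congrArg (cls _ _) (Subtype.ext ?_)
    change ((0 : ℤ) * 0).negOnePow • B.comp _ f'.1 x.1 = B.comp _ f'.1 x.1
    rw [zero_mul, Int.negOnePow_zero, one_smul])

instance (B : DGCat.{w, v, u} k) : (modH0 B).Additive where
  map_add {_ _ f g} := NatTrans.ext (funext fun b =>
    ((evDG B.op (CdgK k) b.unop.as).H0 ⋙ cohFunctor k 0).map_add (f := f) (g := g))

instance (B : DGCat.{w, v, u} k) : (modH0 B).Linear k where
  map_smul f r := NatTrans.ext (funext fun b =>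
    ((evDG B.op (CdgK k) b.unop.as).H0 ⋙ cohFunctor k 0).map_smul r f)

/-- A morphism of the homotopy category of complexes is a quasi-isomorphism if it is bijective
on cohomology in every degree. -/
def cxQis (k : Type w) [CommRing k] : MorphismProperty (H0 (CdgK.{w, v} k)) :=
  fun _ _ f => ∀ n : ℤ, IsIso ((cohFunctor k n).map f)

/-- The quasi-isomorphisms of right `B`-dg-modules: those `M ⟶ N` such that `M(b) ⟶ N(b)` is
a quasi-isomorphism for all `b`. -/
def modQis (B : DGCat.{w, v, u} k) : MorphismProperty (HoMod B) :=
  fun _ _ f => ∀ b : B.Obj, cxQis k ((evDG B.op (CdgK k) b).H0.map f)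

/-- The derived category of right `B`-dg-modules: the localization of the homotopy category
at the quasi-isomorphisms. -/
abbrev DMod (B : DGCat.{w, v, u} k) := (modQis B).Localization

lemma modH0_inverts (B : DGCat.{w, v, u} k) : (modQis B).IsInvertedBy (modH0 B) := by
  intro M N f hf
  rw [NatTrans.isIso_iff_isIso_app]
  intro b
  exact hf b.unop.as 0

/-- Objectwise zeroth cohomology on the derived category of right `B`-dg-modules. -/
def dModH0 (B : DGCat.{w, v, u} k) : DMod B ⥤ ((H0 B)ᵒᵖ ⥤ ModuleCat.{v} k) :=
  Localization.Construction.lift (modH0 B) (modH0_inverts B)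

end Modules

section Bimodules

variable (A : DGCat.{w, v₁, u₁} k) (B : DGCat.{w, v, u} k)

/-- The dg-category of `A`-`B`-dg-bimodules (covariant in `A`, contravariant in `B`), viewed as
dg-functors from `A` to right `B`-dg-modules; by currying this is the dg-category of right
dg-modules over `B ⊗ Aᵒᵖ`. -/
def DGBimod : DGCat.{w, max u v u₁, max u u₁ v v₁ w (v + 1)} k := FunDG A (DGMod B)

/-- The homotopy category of `A`-`B`-dg-bimodules. -/
abbrev HoBimod := H0 (DGBimod A B)

/-- The quasi-isomorphisms of bimodules: those `T ⟶ T'` such that `T(a)(b) ⟶ T'(a)(b)` is a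
quasi-isomorphism for all `a` and `b`. -/
def bimodQis : MorphismProperty (HoBimod A B) :=
  fun _ _ f => ∀ a : A.Obj, modQis B ((evDG A (DGMod B) a).H0.map f)

/-- The derived category of `A`-`B`-dg-bimodules. -/
abbrev DBimod := (bimodQis A B).Localization

/-- The functor `T ↦ T(a)` between derived categories. -/
def dEval (a : A.Obj) : DBimod A B ⥤ DMod B :=
  Localization.Construction.lift ((evDG A (DGMod B) a).H0 ⋙ (modQis B).Q)
    (fun _ _ _ hf => MorphismProperty.Q_inverts _ _ (hf a))

/-- A bimodule `T` is right quasi-representable if for every `a` the right `B`-dg-module `T(a)` is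
isomorphic in the derived category to `B(-, b)` for some object `b` of `B`. -/
def IsRqr : ObjectProperty (DBimod A B) := fun T =>
  ∀ a : A.Obj, ∃ b : B.Obj,
    Nonempty ((dEval A B a).obj T ≅ (modQis B).Q.obj ⟨yonedaDG B b⟩)

/-- The category `H⁰(RHom(A, B))` of quasi-functors from `A` to `B`: the full subcategory of the
derived category of bimodules on the right quasi-representable ones. -/
abbrev QuasiFun := (IsRqr A B).FullSubcategory

/-- The functor sending a bimodule `T` to its objectwise zeroth cohomology
`a ↦ (b ↦ H⁰(T(a)(b)))`. -/
def bimodH0 : HoBimod A B ⥤ (H0 A ⥤ (H0 B)ᵒᵖ ⥤ ModuleCat.{v} k) :=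
  H0Fun A (DGMod B) ⋙ (Functor.whiskeringRight _ _ _).obj (modH0 B)

lemma bimodH0_inverts : (bimodQis A B).IsInvertedBy (bimodH0 A B) := by
  intro M N f hf
  rw [NatTrans.isIso_iff_isIso_app]
  intro a
  exact modH0_inverts B _ (hf a.as)

/-- Objectwise zeroth cohomology on the derived category of bimodules. -/
def dBimodH0 : DBimod A B ⥤ (H0 A ⥤ (H0 B)ᵒᵖ ⥤ ModuleCat.{v} k) :=
  Localization.Construction.lift (bimodH0 A B) (bimodH0_inverts A B)

/-- The property of being a `k`-linear functor. -/
def IsLinFun (k : Type w) [CommRing k] (C : Type u₁) [Category.{v₁} C] [Preadditive C]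
    [Linear k C] (D : Type u₂) [Category.{v₂} D] [Preadditive D] [Linear k D] : ObjectProperty (C ⥤ D) :=
    fun F => F.Additive ∧ F.Linear k

/-- The category of `k`-linear functors and natural transformations. -/
abbrev LinFun (k : Type w) [CommRing k] (C : Type u₁) [Category.{v₁} C] [Preadditive C]
    [Linear k C] (D : Type u₂) [Category.{v₂} D] [Preadditive D] [Linear k D] :=
   (IsLinFun k C D).FullSubcategory

/-- Postcomposition with the Yoneda embedding of `H⁰(B)`, on `k`-linear functors; it is fully
faithful. -/
def linPost : LinFun k (H0 A) (H0 B) ⥤ (H0 A ⥤ (H0 B)ᵒᵖ ⥤ ModuleCat.{v} k) :=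
  (IsLinFun k (H0 A) (H0 B)).ι ⋙ (Functor.whiskeringRight _ _ _).obj (linearYoneda k (H0 B))

instance : (linPost A B).Full := by unfold linPost; infer_instance
instance : (linPost A B).Faithful := by unfold linPost; infer_instance

lemma rqr_representable (T : QuasiFun A B) (a : H0 A) :
    (linearYoneda k (H0 B)).essImage (((dBimodH0 A B).obj T.obj).obj a) := by
  obtain ⟨b, ⟨e⟩⟩ := T.property a.as
  exact ⟨⟨b⟩, ⟨((dModH0 B).mapIso e ≪≫ modH0Yoneda B b).symm⟩⟩

lemma rqr_mem_essImage (T : QuasiFun A B) :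
    (linPost A B).essImage ((dBimodH0 A B).obj T.obj) := by
  let F : H0 A ⥤ H0 B := Functor.essImage.liftFunctor ((dBimodH0 A B).obj T.obj)
    (linearYoneda k (H0 B)) (rqr_representable A B T)
  have e : F ⋙ linearYoneda k (H0 B) ≅ (dBimodH0 A B).obj T.obj :=
    Functor.essImage.liftFunctorCompIso _ _ (rqr_representable A B T)
  let T' : DGFun A (DGMod B) := ((Localization.Construction.objEquiv _).symm T.obj).as
  have hadd : ((dBimodH0 A B).obj T.obj).Additive :=
    inferInstanceAs (T'.H0 ⋙ modH0 B).Additive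
  have hlin : ((dBimodH0 A B).obj T.obj).Linear k :=
    inferInstanceAs ((T'.H0 ⋙ modH0 B).Linear k)
  have hadd' : (F ⋙ linearYoneda k (H0 B)).Additive := Functor.additive_of_iso e.symm
  have hlin' : (F ⋙ linearYoneda k (H0 B)).Linear k := Functor.linear_of_iso k e.symm
  refine ⟨⟨F, ⟨fun {X Y f g} => ?_⟩, ⟨fun {X Y} f r => ?_⟩⟩, ⟨e⟩⟩
  · refine (linearYoneda k (H0 B)).map_injective ((hadd'.map_add (f := f) (g := g)).trans ?_)
    refine NatTrans.ext (funext fun b => ModuleCat.hom_ext (LinearMap.ext fun x => ?_))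
    exact (Preadditive.comp_add _ _ _ x (F.map f) (F.map g)).symm
  · refine (linearYoneda k (H0 B)).map_injective ((hlin'.map_smul f r).trans ?_)
    refine NatTrans.ext (funext fun b => ModuleCat.hom_ext (LinearMap.ext fun x => ?_))
    exact (Linear.comp_smul _ _ _ x r (F.map f)).symm

/-- The functor sending a quasi-functor `T` to the functor `H⁰(T) : H⁰(A) ⥤ H⁰(B)` whose
composite with the Yoneda embedding of `H⁰(B)` is the objectwise zeroth cohomology
`a ↦ H⁰(T(a)(-))` of `T`, a representable presheaf for every `a`; on morphisms it is given by
zeroth cohomology and full faithfulness of the Yoneda embedding. -/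
def quasiFunH0 : QuasiFun A B ⥤ LinFun k (H0 A) (H0 B) :=
  Functor.essImage.liftFunctor ((IsRqr A B).ι ⋙ dBimodH0 A B) (linPost A B)
    (rqr_mem_essImage A B)

end Bimodules

end

end DG

/-! Composing with the fully faithful Yoneda embedding of `H0 B` turns the hypothesis into this: for
every object `a`, the morphism `φ_a : T(a) ⟶ T'(a)` of the derived category of `B` is an isomorphism
on objectwise zeroth cohomology. Both modules are isomorphic there to representables `B(-, b)` and
`B(-, b')`. Zeroth cohomology at `c` is corepresented by `B(-, c)` in the derived category
(`dMod_yoneda_bijective`). Hence composition with `φ_a` is bijective on morphisms out of every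
representable, and taking `c = b'` and `c = b` produces an inverse (`isIso_of_isIso_dModH0_yoneda`).
Degree zero is therefore enough: the other degrees follow because `φ_a` is invertible in the derived
category.

It remains to pass from all `φ_a` to `φ` (`isIso_of_isIso_dEval`). Write `φ` as a fraction with
numerator `f` and a quasi-isomorphism as denominator. Each value of `f` becomes invertible in the
derived category of `B`, where cohomology in all degrees is defined, so `f` is itself a
quasi-isomorphism.

Both arguments use the existence of fractions, but never a criterion for two fractions to be equal;
thus only the Ore condition is needed. It comes from homotopy pushouts. These are described by
equations between morphisms, so every dg-functor preserves them and they can be built objectwise: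
mapping cones give them for complexes, and two passages to dg-functors give them for modules and
bimodules. -/

namespace DG

noncomputable section

/-! ### Fractions in a localization. -/

/-- Under the left Ore condition, every morphism of the localization is a left fraction. -/
lemma exists_fraction {C : Type u} [Category.{v} C] (W : MorphismProperty C) [W.IsMultiplicative]
    (ore : ∀ ⦃X X' Y : C⦄ (s : X ⟶ X') (f : X ⟶ Y), W s →
      ∃ (Z : C) (f' : X' ⟶ Z) (s' : Y ⟶ Z), W s' ∧ s ≫ f' = f ≫ s')
    {X Y : C} (φ : W.Q.obj X ⟶ W.Q.obj Y) :
    ∃ (Z : C) (f : X ⟶ Z) (s : Y ⟶ Z), W s ∧ φ ≫ W.Q.map s = W.Q.map f := by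
  -- Every object of the localization equals some `W.Q.obj X`, but not definitionally, so the
  -- property quantifies over such presentations.
  let P : MorphismProperty W.Localization := fun M N φ =>
    ∀ (X Y : C) (hX : W.Q.obj X = M) (hY : W.Q.obj Y = N),
      ∃ (Z : C) (f : X ⟶ Z) (s : Y ⟶ Z), W s ∧
        eqToHom hX ≫ φ ≫ eqToHom hY.symm ≫ W.Q.map s = W.Q.map f
  have hQ : ∀ {X Y : C}, W.Q.obj X = W.Q.obj Y → X = Y := fun h =>
    (Localization.Construction.objEquiv W).injective h
  have : P.IsStableUnderComposition := ⟨fun {M N' K} φ ψ hφ hψ X Y hX hY => by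
    obtain ⟨N, hN⟩ : ∃ N, W.Q.obj N = N' := (Localization.Construction.objEquiv W).surjective N'
    subst hN
    obtain ⟨Z₁, f, s, hs, h₁⟩ := hφ X N hX rfl
    obtain ⟨Z₂, g, t, ht, h₂⟩ := hψ N Y rfl hY
    -- The Ore square moves the denominator `s` of the first fraction past the numerator `g` of the
    -- second.
    obtain ⟨Z, g', s', hs', h⟩ := ore s g hs
    refine ⟨Z, f ≫ g', t ≫ s', W.comp_mem _ _ ht hs', ?_⟩
    have h₁' := congrArg (· ≫ W.Q.map g') h₁
    have h₂' := congrArg (· ≫ W.Q.map s') h₂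
    simp only [eqToHom_refl, Category.id_comp, Category.assoc] at h₁' h₂'
    simp only [Functor.map_comp, Category.assoc]
    rw [← h₁', h₂', ← W.Q.map_comp, ← W.Q.map_comp, h]⟩
  have hP : P = ⊤ := Localization.Construction.morphismProperty_eq_top P
    (fun X Y f X' Y' hX hY => by
      obtain rfl := hQ hX
      obtain rfl := hQ hY
      exact ⟨_, f, 𝟙 _, W.id_mem _, by simp⟩)
    (fun X Y w hw X' Y' hX hY => by
      obtain rfl := hQ hX
      obtain rfl := hQ hY
      -- A formal inverse of `w` is the fraction with numerator `𝟙` and denominator `w`.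
      refine ⟨_, 𝟙 _, w, hw, ?_⟩
      rw [← cancel_epi (Localization.Construction.wIso w hw).hom]
      simp
      simp [Localization.Construction.wIso])
  have := (show P φ by rw [hP]; trivial) X Y rfl rfl
  simpa using this

variable {k : Type w} [CommRing k]

/-! ### Signs and pasting of squares in a dg-category. -/

namespace DGCat

variable (C : DGCat.{w, v, u} k) {X Y Z : C.Obj} {p q n : ℤ}

lemma comp_units_smul (h : p + q = n) (f : (C.Hom X Y).X p) (g : (C.Hom Y Z).X q) (ε : ℤˣ) :
    C.comp h f (ε • g) = ε • C.comp h f g := LinearMap.map_smul_of_tower _ ε g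

lemma units_smul_comp (h : p + q = n) (f : (C.Hom X Y).X p) (g : (C.Hom Y Z).X q) (ε : ℤˣ) :
    C.comp h (ε • f) g = ε • C.comp h f g := by
  rw [LinearMap.map_smul_of_tower, LinearMap.smul_apply]

lemma d_units_smul (m : ℤ) (f : (C.Hom X Y).X n) (ε : ℤˣ) :
    (C.Hom X Y).d n m (ε • f) = ε • (C.Hom X Y).d n m f :=
  LinearMap.map_smul_of_tower ((C.Hom X Y).d n m).hom ε f

lemma comp_sub (h : p + q = n) (f : (C.Hom X Y).X p) (g g' : (C.Hom Y Z).X q) :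
    C.comp h f (g - g') = C.comp h f g - C.comp h f g' := map_sub _ _ _

lemma sub_comp (h : p + q = n) (f f' : (C.Hom X Y).X p) (g : (C.Hom Y Z).X q) :
    C.comp h (f - f') g = C.comp h f g - C.comp h f' g := by
  rw [map_sub, LinearMap.sub_apply]

/-- Horizontal pasting of two squares that commute up to signs. -/
lemma comp_square {X₁ X₂ X₃ Y₁ Y₂ Y₃ : C.Obj} {e p q n a b c : ℤ} {i₁ : (C.Hom X₁ Y₁).X e}
    {i₂ : (C.Hom X₂ Y₂).X e} {i₃ : (C.Hom X₃ Y₃).X e} {x : (C.Hom X₁ X₂).X p}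
    {x' : (C.Hom X₂ X₃).X q} {y : (C.Hom Y₁ Y₂).X p} {y' : (C.Hom Y₂ Y₃).X q} {ε ε' : ℤˣ}
    (h : p + q = n) (h₁ : e + p = a) (h₂ : p + e = a) (h₃ : e + q = b) (h₄ : q + e = b)
    (h₅ : e + n = c) (h₆ : n + e = c)
    (H : C.comp h₁ i₁ y = ε • C.comp h₂ x i₂) (H' : C.comp h₃ i₂ y' = ε' • C.comp h₄ x' i₃) :
    C.comp h₅ i₁ (C.comp h y y') = (ε * ε') • C.comp h₆ (C.comp h x x') i₃ := by
  rw [← C.assoc h₁ h (by omega) h₅, H, units_smul_comp, C.assoc h₂ h₃ (by omega) (by omega), H',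
    comp_units_smul, smul_smul, C.assoc h h₄ h₆ (by omega)]

/-- Vertical pasting of two commutative squares with vertical sides of degree zero. -/
lemma comp_square' {X₁ X₂ Y₁ Y₂ Z₁ Z₂ : C.Obj} {n : ℤ} {i₁ : (C.Hom X₁ Y₁).X 0}
    {i₂ : (C.Hom X₂ Y₂).X 0} {j₁ : (C.Hom Y₁ Z₁).X 0} {j₂ : (C.Hom Y₂ Z₂).X 0}
    {x : (C.Hom X₁ X₂).X n} {y : (C.Hom Y₁ Y₂).X n} {z : (C.Hom Z₁ Z₂).X n}
    (H : C.comp (zero_add n) i₁ y = C.comp (add_zero n) x i₂)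
    (H' : C.comp (zero_add n) j₁ z = C.comp (add_zero n) y j₂) :
    C.comp (zero_add n) (C.comp (add_zero 0) i₁ j₁) z =
      C.comp (add_zero n) x (C.comp (add_zero 0) i₂ j₂) := by
  rw [C.assoc (add_zero 0) (zero_add n) (zero_add n) (zero_add n), H',
    ← C.assoc (zero_add n) (add_zero n) (add_zero n) (zero_add n), H,
    C.assoc (add_zero n) (add_zero 0) (add_zero n) (add_zero n)]

end DGCat

/-! ### Homotopy pushouts in a dg-category. -/

/-- A homotopy pushout of `s : X ⟶ X'` and `f : X ⟶ Y`, morphisms of degree zero in a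
dg-category: an object with underlying graded object `X' ⊕ Y ⊕ X[1]`, given by its injections
`inl`, `inr`, `htpy` and its projections `fst`, `snd`, `proj`, such that `htpy` is a homotopy
between the two composites `X ⟶ pt`. -/
structure HPushout (C : DGCat.{w, v, u} k) {X X' Y : C.Obj} (s : (C.Hom X X').X 0)
    (f : (C.Hom X Y).X 0) where
  pt : C.Obj
  inl : (C.Hom X' pt).X 0
  inr : (C.Hom Y pt).X 0
  htpy : (C.Hom X pt).X (-1)
  fst : (C.Hom pt X').X 0
  snd : (C.Hom pt Y).X 0
  proj : (C.Hom pt X).X 1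
  d_inl : (C.Hom X' pt).d 0 1 inl = 0
  d_inr : (C.Hom Y pt).d 0 1 inr = 0
  d_htpy : (C.Hom X pt).d (-1) 0 htpy =
    C.comp (add_zero 0) s inl - C.comp (add_zero 0) f inr
  inl_fst : C.comp (add_zero 0) inl fst = C.id X'
  inl_snd : C.comp (add_zero 0) inl snd = 0
  inl_proj : C.comp (zero_add 1) inl proj = 0
  inr_fst : C.comp (add_zero 0) inr fst = 0
  inr_snd : C.comp (add_zero 0) inr snd = C.id Y
  inr_proj : C.comp (zero_add 1) inr proj = 0
  htpy_fst : C.comp (add_zero (-1)) htpy fst = 0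
  htpy_snd : C.comp (add_zero (-1)) htpy snd = 0
  htpy_proj : C.comp (neg_add_cancel 1) htpy proj = C.id X
  total : C.comp (add_zero 0) fst inl + C.comp (add_zero 0) snd inr +
    C.comp (add_neg_cancel 1) proj htpy = C.id pt

namespace HPushout

variable {C : DGCat.{w, v, u} k} {X X' Y : C.Obj} {s : (C.Hom X X').X 0} {f : (C.Hom X Y).X 0}

/-- The image of a homotopy pushout under a dg-functor. -/
def map (P : HPushout C s f) {D : DGCat.{w, v₁, u₁} k} (F : DGFun C D) :
    HPushout D (F.map 0 s) (F.map 0 f) where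
  pt := F.obj P.pt
  inl := F.map 0 P.inl
  inr := F.map 0 P.inr
  htpy := F.map (-1) P.htpy
  fst := F.map 0 P.fst
  snd := F.map 0 P.snd
  proj := F.map 1 P.proj
  d_inl := by rw [← F.map_d (zero_add 1), P.d_inl, map_zero]
  d_inr := by rw [← F.map_d (zero_add 1), P.d_inr, map_zero]
  d_htpy := by
    rw [← F.map_d (neg_add_cancel 1), P.d_htpy, map_sub, F.map_comp, F.map_comp]
  inl_fst := by rw [← F.map_comp, P.inl_fst, F.map_id]
  inl_snd := by rw [← F.map_comp, P.inl_snd, map_zero]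
  inl_proj := by rw [← F.map_comp, P.inl_proj, map_zero]
  inr_fst := by rw [← F.map_comp, P.inr_fst, map_zero]
  inr_snd := by rw [← F.map_comp, P.inr_snd, F.map_id]
  inr_proj := by rw [← F.map_comp, P.inr_proj, map_zero]
  htpy_fst := by rw [← F.map_comp, P.htpy_fst, map_zero]
  htpy_snd := by rw [← F.map_comp, P.htpy_snd, map_zero]
  htpy_proj := by rw [← F.map_comp, P.htpy_proj, F.map_id]
  total := by
    rw [← F.map_comp, ← F.map_comp, ← F.map_comp, ← map_add, ← map_add, P.total, F.map_id]

variable (P : HPushout C s f)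

/-- The morphism out of a homotopy pushout with given restrictions along the injections. -/
def desc {W : C.Obj} {n m : ℤ} (h : -1 + n = m) (α : (C.Hom X' W).X n) (β : (C.Hom Y W).X n)
    (γ : (C.Hom X W).X m) : (C.Hom P.pt W).X n :=
  C.comp (zero_add n) P.fst α + C.comp (zero_add n) P.snd β +
    C.comp (by omega : 1 + m = n) P.proj γ

section

variable {W : C.Obj} {n m : ℤ} (h : -1 + n = m) (α : (C.Hom X' W).X n) (β : (C.Hom Y W).X n)
  (γ : (C.Hom X W).X m)

lemma inl_desc : C.comp (zero_add n) P.inl (P.desc h α β γ) = α := by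
  rw [desc, map_add, map_add, ← C.assoc (add_zero 0) _ (zero_add n), P.inl_fst, C.id_comp,
    ← C.assoc (add_zero 0) _ (zero_add n), P.inl_snd, ← C.assoc (zero_add 1) _ (by omega),
    P.inl_proj]
  simp

lemma inr_desc : C.comp (zero_add n) P.inr (P.desc h α β γ) = β := by
  rw [desc, map_add, map_add, ← C.assoc (add_zero 0) _ (zero_add n), P.inr_fst,
    ← C.assoc (add_zero 0) _ (zero_add n), P.inr_snd, C.id_comp,
    ← C.assoc (zero_add 1) _ (by omega), P.inr_proj]
  simp

lemma htpy_desc : C.comp h P.htpy (P.desc h α β γ) = γ := by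
  rw [desc, map_add, map_add, ← C.assoc (add_zero (-1)) _ h, P.htpy_fst,
    ← C.assoc (add_zero (-1)) _ h, P.htpy_snd, ← C.assoc (neg_add_cancel 1) _ (zero_add m),
    P.htpy_proj, C.id_comp]
  simp

-- By `total`, a morphism out of `pt` is the sum of its restrictions along the three injections,
-- each preceded by the matching projection.
include h in
lemma hom_ext {x y : (C.Hom P.pt W).X n}
    (h₁ : C.comp (zero_add n) P.inl x = C.comp (zero_add n) P.inl y)
    (h₂ : C.comp (zero_add n) P.inr x = C.comp (zero_add n) P.inr y)
    (h₃ : C.comp h P.htpy x = C.comp h P.htpy y) : x = y := by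
  have key : ∀ z : (C.Hom P.pt W).X n, z = C.comp (zero_add n) P.fst (C.comp (zero_add n) P.inl z) +
      C.comp (zero_add n) P.snd (C.comp (zero_add n) P.inr z) +
      C.comp (by omega : 1 + m = n) P.proj (C.comp h P.htpy z) := fun z => by
    conv_lhs => rw [← C.id_comp z, ← P.total]
    rw [map_add, map_add, LinearMap.add_apply, LinearMap.add_apply,
      C.assoc (add_zero 0) (zero_add n) _ (zero_add n),
      C.assoc (add_zero 0) (zero_add n) _ (zero_add n),
      C.assoc (add_neg_cancel 1) h _ (by omega)]
  rw [key x, key y, h₁, h₂, h₃]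

end

/-- The differentials of the three projections are forced by the other data: differentiate the
relations between injections and projections, then compare restrictions with `hom_ext`. -/
lemma d_proj : (C.Hom P.pt X).d 1 2 P.proj = 0 := by
  refine P.hom_ext (m := 1) (by norm_num) ?_ ?_ ?_
  · have := congrArg ((C.Hom _ _).d 1 2) P.inl_proj
    rw [C.d_comp _ (zero_add 1) one_add_one_eq_two one_add_one_eq_two, P.d_inl] at this
    simpa using this
  · have := congrArg ((C.Hom _ _).d 1 2) P.inr_proj
    rw [C.d_comp _ (zero_add 1) one_add_one_eq_two one_add_one_eq_two, P.d_inr] at this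
    simpa using this
  · have := congrArg ((C.Hom _ _).d 0 1) P.htpy_proj
    rw [C.d_comp _ (neg_add_cancel 1) one_add_one_eq_two (zero_add 1), P.d_htpy, C.d_id, map_sub,
      LinearMap.sub_apply, C.assoc (add_zero 0) (zero_add 1) _ (zero_add 1), P.inl_proj,
      C.assoc (add_zero 0) (zero_add 1) _ (zero_add 1), P.inr_proj] at this
    simpa using this

lemma d_fst : (C.Hom P.pt X').d 0 1 P.fst = - C.comp (add_zero 1) P.proj s := by
  refine P.hom_ext (m := 0) (by norm_num) ?_ ?_ ?_
  · have := congrArg ((C.Hom _ _).d 0 1) P.inl_fst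
    rw [C.d_comp _ (zero_add 1) (zero_add 1) (zero_add 1), P.d_inl, C.d_id] at this
    rw [map_neg, ← C.assoc (zero_add 1) _ (add_zero 1), P.inl_proj]
    simpa using this
  · have := congrArg ((C.Hom _ _).d 0 1) P.inr_fst
    rw [C.d_comp _ (zero_add 1) (zero_add 1) (zero_add 1), P.d_inr] at this
    rw [map_neg, ← C.assoc (zero_add 1) _ (add_zero 1), P.inr_proj]
    simpa using this
  · have := congrArg ((C.Hom _ _).d (-1) 0) P.htpy_fst
    rw [C.d_comp _ (neg_add_cancel 1) (zero_add 1) (neg_add_cancel 1), P.d_htpy, map_sub,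
      LinearMap.sub_apply, C.assoc (add_zero 0) (add_zero 0) _ (zero_add 0), P.inl_fst,
      C.assoc (add_zero 0) (add_zero 0) _ (zero_add 0), P.inr_fst, C.comp_id, map_zero,
      sub_zero, map_zero, Int.negOnePow_zero, one_smul] at this
    rw [map_neg, ← C.assoc (neg_add_cancel 1) _ (zero_add 0), P.htpy_proj, C.id_comp]
    exact eq_neg_of_add_eq_zero_left this

lemma d_snd : (C.Hom P.pt Y).d 0 1 P.snd = C.comp (add_zero 1) P.proj f := by
  refine P.hom_ext (m := 0) (by norm_num) ?_ ?_ ?_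
  · have := congrArg ((C.Hom _ _).d 0 1) P.inl_snd
    rw [C.d_comp _ (zero_add 1) (zero_add 1) (zero_add 1), P.d_inl] at this
    rw [← C.assoc (zero_add 1) _ (add_zero 1), P.inl_proj]
    simpa using this
  · have := congrArg ((C.Hom _ _).d 0 1) P.inr_snd
    rw [C.d_comp _ (zero_add 1) (zero_add 1) (zero_add 1), P.d_inr, C.d_id] at this
    rw [← C.assoc (zero_add 1) _ (add_zero 1), P.inr_proj]
    simpa using this
  · have := congrArg ((C.Hom _ _).d (-1) 0) P.htpy_snd
    rw [C.d_comp _ (neg_add_cancel 1) (zero_add 1) (neg_add_cancel 1), P.d_htpy, map_sub,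
      LinearMap.sub_apply, C.assoc (add_zero 0) (add_zero 0) _ (zero_add 0), P.inl_snd,
      C.assoc (add_zero 0) (add_zero 0) _ (zero_add 0), P.inr_snd, C.comp_id, map_zero,
      zero_sub, map_zero, Int.negOnePow_zero, one_smul] at this
    rw [← C.assoc (neg_add_cancel 1) _ (zero_add 0), P.htpy_proj, C.id_comp]
    exact add_neg_eq_zero.1 this

end HPushout

/-- A dg-category has homotopy pushouts if all pairs of closed morphisms of degree zero with the
same source have one. -/
def HasHPushouts (C : DGCat.{w, v, u} k) : Prop :=
  ∀ ⦃X X' Y : C.Obj⦄ (s : (C.Hom X X').X 0) (f : (C.Hom X Y).X 0),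
    (C.Hom X X').d 0 1 s = 0 → (C.Hom X Y).d 0 1 f = 0 → Nonempty (HPushout C s f)

/-! ### Homotopy pushouts of dg-functors, computed objectwise. -/

section FunDG

variable {A : DGCat.{w, v₁, u₁} k} {C : DGCat.{w, v₂, u₂} k}
  {F F' G : DGFun A C} {s : dgNatTrans F F' 0} {f : dgNatTrans F G 0}

lemma dgNatTrans_zero_naturality (φ : dgNatTrans F G 0) {X Y : A.Obj} {n : ℤ}
    (g : (A.Hom X Y).X n) :
    C.comp (zero_add n) (φ.1 X) (G.map n g) = C.comp (add_zero n) (F.map n g) (φ.1 Y) := by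
  simpa using φ.2 (zero_add n) (add_zero n) g

/-- The action on morphisms of the dg-functor given by objectwise homotopy pushouts. -/
def hpushoutMap (P : ∀ X, HPushout C (s.1 X) (f.1 X)) {X Y : A.Obj} (n : ℤ) :
    (A.Hom X Y).X n →ₗ[k] (C.Hom (P X).pt (P Y).pt).X n where
  toFun g := (P X).desc (m := n - 1) (by omega)
    (C.comp (add_zero n) (F'.map n g) (P Y).inl)
    (C.comp (add_zero n) (G.map n g) (P Y).inr)
    -- The Koszul sign for exchanging `g` with `htpy`, of degree `-1`; it makes the `htpy`
    -- dg-natural of that degree.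
    (n.negOnePow • C.comp (by omega) (F.map n g) (P Y).htpy)
  map_add' a b := by
    simp only [HPushout.desc, map_add, LinearMap.add_apply, smul_add]
    abel
  map_smul' r a := by
    simp only [HPushout.desc, map_smul, LinearMap.smul_apply, RingHom.id_apply, smul_add,
      smul_comm _ r]

section

variable (P : ∀ X, HPushout C (s.1 X) (f.1 X)) {X Y : A.Obj} {n : ℤ} (g : (A.Hom X Y).X n)

lemma inl_hpushoutMap : C.comp (zero_add n) (P X).inl (hpushoutMap P n g) =
    C.comp (add_zero n) (F'.map n g) (P Y).inl :=
  (P X).inl_desc (by omega) _ _ _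

lemma inr_hpushoutMap : C.comp (zero_add n) (P X).inr (hpushoutMap P n g) =
    C.comp (add_zero n) (G.map n g) (P Y).inr :=
  (P X).inr_desc (by omega) _ _ _

lemma htpy_hpushoutMap {m : ℤ} (h : -1 + n = m) :
    C.comp h (P X).htpy (hpushoutMap P n g) =
      n.negOnePow • C.comp (by omega : n + -1 = m) (F.map n g) (P Y).htpy := by
  obtain rfl : m = n - 1 := by omega
  exact (P X).htpy_desc (by omega) _ _ _

end

-- From here on the map is handled through its three restrictions, which determine it by `hom_ext`.
attribute [irreducible] hpushoutMap

section

variable (P : ∀ X, HPushout C (s.1 X) (f.1 X)) {X Y : A.Obj} {n m : ℤ} (h : n + 1 = m)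
  (g : (A.Hom X Y).X n)

include h

lemma inl_d_hpushoutMap :
    C.comp (zero_add m) (P X).inl ((C.Hom (P X).pt (P Y).pt).d n m (hpushoutMap P n g)) =
      C.comp (add_zero m) (F'.map m ((A.Hom X Y).d n m g)) (P Y).inl := by
  have := congrArg ((C.Hom _ _).d n m) (inl_hpushoutMap P g)
  rw [C.d_comp _ (zero_add 1) h h, C.d_comp _ h (zero_add 1) h, (P X).d_inl, (P Y).d_inl] at this
  rw [F'.map_d h]
  simpa using this

lemma inr_d_hpushoutMap :
    C.comp (zero_add m) (P X).inr ((C.Hom (P X).pt (P Y).pt).d n m (hpushoutMap P n g)) =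
      C.comp (add_zero m) (G.map m ((A.Hom X Y).d n m g)) (P Y).inr := by
  have := congrArg ((C.Hom _ _).d n m) (inr_hpushoutMap P g)
  rw [C.d_comp _ (zero_add 1) h h, C.d_comp _ h (zero_add 1) h, (P X).d_inr, (P Y).d_inr] at this
  rw [G.map_d h]
  simpa using this

omit h in
-- The differential of `htpy` is a difference of two composites, `s` with `inl` and `f` with `inr`;
-- each is natural by pasting two commutative squares.
lemma d_htpy_hpushoutMap :
    C.comp (zero_add n) ((C.Hom _ _).d (-1) 0 (P X).htpy) (hpushoutMap P n g) =
      C.comp (add_zero n) (F.map n g) ((C.Hom _ _).d (-1) 0 (P Y).htpy) := by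
  rw [(P X).d_htpy, (P Y).d_htpy, C.sub_comp, C.comp_sub,
    C.comp_square' (dgNatTrans_zero_naturality s g) (inl_hpushoutMap P g),
    C.comp_square' (dgNatTrans_zero_naturality f g) (inr_hpushoutMap P g)]

/-- Differentiate `htpy_hpushoutMap`. The terms containing the differential of `htpy` cancel by
`d_htpy_hpushoutMap`, and the remaining sign changes from degree `n` to `m = n + 1`. -/
lemma htpy_d_hpushoutMap (h' : -1 + m = n) :
    C.comp h' (P X).htpy ((C.Hom (P X).pt (P Y).pt).d n m (hpushoutMap P n g)) =
      m.negOnePow • C.comp (by omega : m + -1 = n) (F.map m ((A.Hom X Y).d n m g))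
        (P Y).htpy := by
  have := congrArg ((C.Hom _ _).d (n - 1) n)
    (htpy_hpushoutMap P g (m := n - 1) (by omega))
  rw [C.d_units_smul] at this
  rw [C.d_comp (p' := 0) _ (neg_add_cancel 1) h (by omega),
    C.d_comp (q' := 0) _ h (neg_add_cancel 1) (by omega), d_htpy_hpushoutMap, smul_add,
    add_comm, add_left_cancel_iff] at this
  subst h
  rw [F.map_d rfl, this, Int.negOnePow_neg,
    Int.negOnePow_one, Int.negOnePow_succ, Units.neg_smul, Units.neg_smul, one_smul, smul_neg]

end

/-- The dg-functor given by objectwise homotopy pushouts. -/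
def hpushoutFun (P : ∀ X, HPushout C (s.1 X) (f.1 X)) : DGFun A C where
  obj X := (P X).pt
  map n := hpushoutMap P n
  map_d {X Y n m} h g := by
    refine (P X).hom_ext (m := n) (by omega) ?_ ?_ ?_
    · rw [inl_hpushoutMap, inl_d_hpushoutMap P h]
    · rw [inr_hpushoutMap, inr_d_hpushoutMap P h]
    · rw [htpy_hpushoutMap, htpy_d_hpushoutMap P h]
  map_id X := by
    refine (P X).hom_ext (m := -1) (by norm_num) ?_ ?_ ?_
    · rw [inl_hpushoutMap, F'.map_id, C.id_comp, C.comp_id]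
    · rw [inr_hpushoutMap, G.map_id, C.id_comp, C.comp_id]
    · rw [htpy_hpushoutMap P, F.map_id, C.id_comp, C.comp_id, Int.negOnePow_zero, one_smul]
  map_comp {X Y Z p q n} h f g := by
    refine (P X).hom_ext (m := n - 1) (by omega) ?_ ?_ ?_
    · refine (inl_hpushoutMap P _).trans ?_
      rw [F'.map_comp h]
      simpa using (C.comp_square (ε := 1) (ε' := 1) h (zero_add p) (add_zero p) (zero_add q)
        (add_zero q) (zero_add n) (add_zero n) (by simpa using inl_hpushoutMap P f)
        (by simpa using inl_hpushoutMap P g)).symm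
    · refine (inr_hpushoutMap P _).trans ?_
      rw [G.map_comp h]
      simpa using (C.comp_square (ε := 1) (ε' := 1) h (zero_add p) (add_zero p) (zero_add q)
        (add_zero q) (zero_add n) (add_zero n) (by simpa using inr_hpushoutMap P f)
        (by simpa using inr_hpushoutMap P g)).symm
    · refine (htpy_hpushoutMap P _ _).trans ?_
      have e : n.negOnePow = p.negOnePow * q.negOnePow := by rw [← h, Int.negOnePow_add]
      rw [F.map_comp h, e]
      exact (C.comp_square h _ _ _ _ _ _ (htpy_hpushoutMap P f rfl)
        (htpy_hpushoutMap P g rfl)).symm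

section

variable (P : ∀ X, HPushout C (s.1 X) (f.1 X)) {X Y : A.Obj} {n : ℤ} (g : (A.Hom X Y).X n)

lemma hpushoutMap_fst : C.comp (zero_add n) (P X).fst (F'.map n g) =
    C.comp (add_zero n) (hpushoutMap P n g) (P Y).fst := by
  have h := zero_add n
  have h' := add_zero n
  refine (P X).hom_ext rfl ?_ ?_ ?_
  · rw [← C.assoc (add_zero 0) h h h, (P X).inl_fst, C.id_comp, ← C.assoc h h' h' h,
      inl_hpushoutMap, C.assoc h' (add_zero 0) h' h', (P Y).inl_fst, C.comp_id]
  · rw [← C.assoc (add_zero 0) h h h, (P X).inr_fst, ← C.assoc h h' h' h, inr_hpushoutMap,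
      C.assoc h' (add_zero 0) h' h', (P Y).inr_fst]
    simp
  · rw [← C.assoc (add_zero (-1)) h rfl rfl, (P X).htpy_fst, ← C.assoc rfl h' (add_zero _) rfl,
      htpy_hpushoutMap P g, C.units_smul_comp,
      C.assoc (by omega) (add_zero (-1)) (add_zero _) (by omega), (P Y).htpy_fst]
    simp

lemma hpushoutMap_snd : C.comp (zero_add n) (P X).snd (G.map n g) =
    C.comp (add_zero n) (hpushoutMap P n g) (P Y).snd := by
  have h := zero_add n
  have h' := add_zero n
  refine (P X).hom_ext rfl ?_ ?_ ?_
  · rw [← C.assoc (add_zero 0) h h h, (P X).inl_snd, ← C.assoc h h' h' h, inl_hpushoutMap,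
      C.assoc h' (add_zero 0) h' h', (P Y).inl_snd]
    simp
  · rw [← C.assoc (add_zero 0) h h h, (P X).inr_snd, C.id_comp, ← C.assoc h h' h' h,
      inr_hpushoutMap, C.assoc h' (add_zero 0) h' h', (P Y).inr_snd, C.comp_id]
  · rw [← C.assoc (add_zero (-1)) h rfl rfl, (P X).htpy_snd, ← C.assoc rfl h' (add_zero _) rfl,
      htpy_hpushoutMap P g, C.units_smul_comp,
      C.assoc (by omega) (add_zero (-1)) (add_zero _) (by omega), (P Y).htpy_snd]
    simp

lemma hpushoutMap_proj {m : ℤ} (h : 1 + n = m) (h' : n + 1 = m) :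
    C.comp h (P X).proj (F.map n g) =
      n.negOnePow • C.comp h' (hpushoutMap P n g) (P Y).proj := by
  have h₀ := zero_add n
  have h₁ := add_zero n
  refine (P X).hom_ext (m := n) (by omega) ?_ ?_ ?_
  · rw [← C.assoc (zero_add 1) h h (by omega), (P X).inl_proj, C.comp_units_smul,
      ← C.assoc h₀ h' h' (by omega), inl_hpushoutMap,
      C.assoc h₁ (zero_add 1) h' h', (P Y).inl_proj]
    simp
  · rw [← C.assoc (zero_add 1) h h (by omega), (P X).inr_proj, C.comp_units_smul,
      ← C.assoc h₀ h' h' (by omega), inr_hpushoutMap,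
      C.assoc h₁ (zero_add 1) h' h', (P Y).inr_proj]
    simp
  · rw [← C.assoc (neg_add_cancel 1) h h₀ (by omega), (P X).htpy_proj, C.id_comp,
      C.comp_units_smul, ← C.assoc rfl h' (by omega) (by omega), htpy_hpushoutMap P g,
      C.units_smul_comp, C.assoc (by omega) (neg_add_cancel 1) (by omega) h₁, (P Y).htpy_proj,
      C.comp_id, smul_smul, ← Int.negOnePow_add, Int.negOnePow_even (n + n) ⟨n, rfl⟩, one_smul]

end

/-- Homotopy pushouts of dg-functors are computed objectwise. -/
def hpushoutFunDG (P : ∀ X, HPushout C (s.1 X) (f.1 X)) :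
    HPushout (FunDG A C) (X := F) (X' := F') (Y := G) s f where
  pt := hpushoutFun P
  inl := ⟨fun X => (P X).inl, fun {X Y q n} h h' g => by
    obtain rfl : q = n := by omega
    rw [zero_mul, Int.negOnePow_zero, one_smul]
    exact inl_hpushoutMap P g⟩
  inr := ⟨fun X => (P X).inr, fun {X Y q n} h h' g => by
    obtain rfl : q = n := by omega
    rw [zero_mul, Int.negOnePow_zero, one_smul]
    exact inr_hpushoutMap P g⟩
  htpy := ⟨fun X => (P X).htpy, fun {X Y q n} h h' g => by
    rw [neg_one_mul, Int.negOnePow_neg]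
    exact htpy_hpushoutMap P g h⟩
  fst := ⟨fun X => (P X).fst, fun {X Y q n} h h' g => by
    obtain rfl : q = n := by omega
    rw [zero_mul, Int.negOnePow_zero, one_smul]
    exact hpushoutMap_fst P g⟩
  snd := ⟨fun X => (P X).snd, fun {X Y q n} h h' g => by
    obtain rfl : q = n := by omega
    rw [zero_mul, Int.negOnePow_zero, one_smul]
    exact hpushoutMap_snd P g⟩
  proj := ⟨fun X => (P X).proj, fun {X Y q n} h h' g => by
    rw [one_mul]
    exact hpushoutMap_proj P g h h'⟩
  d_inl := Subtype.ext (funext fun X => (P X).d_inl)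
  d_inr := Subtype.ext (funext fun X => (P X).d_inr)
  d_htpy := Subtype.ext (funext fun X => (P X).d_htpy)
  inl_fst := Subtype.ext (funext fun X => (P X).inl_fst)
  inl_snd := Subtype.ext (funext fun X => (P X).inl_snd)
  inl_proj := Subtype.ext (funext fun X => (P X).inl_proj)
  inr_fst := Subtype.ext (funext fun X => (P X).inr_fst)
  inr_snd := Subtype.ext (funext fun X => (P X).inr_snd)
  inr_proj := Subtype.ext (funext fun X => (P X).inr_proj)
  htpy_fst := Subtype.ext (funext fun X => (P X).htpy_fst)
  htpy_snd := Subtype.ext (funext fun X => (P X).htpy_snd)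
  htpy_proj := Subtype.ext (funext fun X => (P X).htpy_proj)
  total := Subtype.ext (funext fun X => (P X).total)

lemma hasHPushouts_funDG (hC : HasHPushouts C) : HasHPushouts (FunDG A C) := by
  intro F F' G s f hs hf
  exact ⟨hpushoutFunDG fun X => (hC _ _ (congrFun (congrArg Subtype.val hs) X)
    (congrFun (congrArg Subtype.val hf) X)).some⟩

end FunDG

/-! ### Homotopy pushouts of complexes as mapping cones. -/

section Complexes

open CochainComplex CochainComplex.HomComplex Limits

lemma hasHPushouts_CdgK : HasHPushouts (CdgK.{w, v} k) := by
  intro X X' Y s f hs hf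
  let X₀ : CochainComplex (ModuleCat.{v} k) ℤ := X
  let X₁ : CochainComplex (ModuleCat.{v} k) ℤ := X'
  let Y₀ : CochainComplex (ModuleCat.{v} k) ℤ := Y
  obtain ⟨s, rfl⟩ : ∃ s' : X₀ ⟶ X₁, Cochain.ofHom s' = s :=
    ⟨_, Cocycle.cochain_ofHom_homOf_eq_coe (Cocycle.mk s 1 (zero_add 1) hs)⟩
  obtain ⟨f, rfl⟩ : ∃ f' : X₀ ⟶ Y₀, Cochain.ofHom f' = f :=
    ⟨_, Cocycle.cochain_ofHom_homOf_eq_coe (Cocycle.mk f 1 (zero_add 1) hf)⟩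
  -- The homotopy pushout is the cone of `(s, -f)`; the minus sign gives the difference required in
  -- `d_htpy`.
  let φ : X₀ ⟶ X₁ ⊞ Y₀ := biprod.lift s (-f)
  refine ⟨{
    pt := mappingCone φ
    inl := Cochain.ofHom ((biprod.inl : X₁ ⟶ X₁ ⊞ Y₀) ≫ mappingCone.inr φ)
    inr := Cochain.ofHom ((biprod.inr : Y₀ ⟶ X₁ ⊞ Y₀) ≫ mappingCone.inr φ)
    htpy := mappingCone.inl φ
    fst := (mappingCone.snd φ).comp (n₁₂ := 0) (Cochain.ofHom biprod.fst) (add_zero 0)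
    snd := (mappingCone.snd φ).comp (n₁₂ := 0) (Cochain.ofHom biprod.snd) (add_zero 0)
    proj := (mappingCone.fst φ).1
    d_inl := δ_ofHom _
    d_inr := δ_ofHom _
    d_htpy := ?_
    inl_fst := ?_
    inl_snd := ?_
    inl_proj := ?_
    inr_fst := ?_
    inr_snd := ?_
    inr_proj := ?_
    htpy_fst := mappingCone.inl_snd_assoc (e := 0) (f := -1) φ (Cochain.ofHom (biprod.fst : X₁ ⊞ Y₀ ⟶ _))
      (add_zero 0) (add_zero (-1))
    htpy_snd := mappingCone.inl_snd_assoc (e := 0) (f := -1) φ (Cochain.ofHom (biprod.snd : X₁ ⊞ Y₀ ⟶ _))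
      (add_zero 0) (add_zero (-1))
    htpy_proj := mappingCone.inl_fst φ
    total := ?_ }⟩
  · refine (mappingCone.δ_inl φ).trans ?_
    change _ = (Cochain.ofHom s).comp (Cochain.ofHom (biprod.inl ≫ mappingCone.inr φ)) (add_zero 0) -
      (Cochain.ofHom f).comp (Cochain.ofHom (biprod.inr ≫ mappingCone.inr φ)) (add_zero 0)
    rw [← Cochain.ofHom_comp, ← Cochain.ofHom_comp, ← Cochain.ofHom_sub]
    congr 1
    simp [φ, biprod.lift_eq, sub_eq_add_neg]
  · change (Cochain.ofHom (biprod.inl ≫ mappingCone.inr φ)).comp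
      ((mappingCone.snd φ).comp (Cochain.ofHom biprod.fst) (add_zero 0)) (add_zero 0) = Cochain.ofHom (𝟙 X₁)
    simp [Cochain.ofHom_comp]
    simp [← Cochain.ofHom_comp]
  · change (Cochain.ofHom (biprod.inl ≫ mappingCone.inr φ)).comp
      ((mappingCone.snd φ).comp (Cochain.ofHom biprod.snd) (add_zero 0)) (add_zero 0) = 0
    simp [Cochain.ofHom_comp]
    simp [← Cochain.ofHom_comp]
  · change (Cochain.ofHom (biprod.inl ≫ mappingCone.inr φ)).comp
      ((mappingCone.fst φ).1) (zero_add 1) = 0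
    simp [Cochain.ofHom_comp]
  · change (Cochain.ofHom (biprod.inr ≫ mappingCone.inr φ)).comp
      ((mappingCone.snd φ).comp (Cochain.ofHom biprod.fst) (add_zero 0)) (add_zero 0) = 0
    simp [Cochain.ofHom_comp]
    simp [← Cochain.ofHom_comp]
  · change (Cochain.ofHom (biprod.inr ≫ mappingCone.inr φ)).comp
      ((mappingCone.snd φ).comp (Cochain.ofHom biprod.snd) (add_zero 0)) (add_zero 0) = Cochain.ofHom (𝟙 Y₀)
    simp [Cochain.ofHom_comp]
    simp [← Cochain.ofHom_comp]
  · change (Cochain.ofHom (biprod.inr ≫ mappingCone.inr φ)).comp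
      ((mappingCone.fst φ).1) (zero_add 1) = 0
    simp [Cochain.ofHom_comp]
  · change ((mappingCone.snd φ).comp (Cochain.ofHom biprod.fst) (add_zero 0)).comp
      (Cochain.ofHom (biprod.inl ≫ mappingCone.inr φ)) (add_zero 0) +
      ((mappingCone.snd φ).comp (Cochain.ofHom biprod.snd) (add_zero 0)).comp
      (Cochain.ofHom (biprod.inr ≫ mappingCone.inr φ)) (add_zero 0) +
      (mappingCone.fst φ).1.comp (mappingCone.inl φ) (add_neg_cancel 1) = Cochain.ofHom (𝟙 _)
    rw [← mappingCone.id φ, add_comm ((mappingCone.fst φ).1.comp _ _),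
      Cochain.comp_assoc_of_second_is_zero_cochain, Cochain.comp_assoc_of_second_is_zero_cochain,
      ← Cochain.ofHom_comp, ← Cochain.ofHom_comp, ← Cochain.comp_add, ← Cochain.ofHom_add,
      ← Category.assoc, ← Category.assoc, ← Preadditive.add_comp, biprod.total, Category.id_comp]

end Complexes

/-! ### Ore squares in the homotopy category. -/

lemma cls_eq_cls {C : CochainComplex (ModuleCat.{v} k) ℤ} {n l : ℤ} (h : l + 1 = n)
    (x y : cocycles C n) : cls C n x = cls C n y ↔ ∃ z : C.X l, C.d l n z = x.1 - y.1 := by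
  rw [← sub_eq_zero, ← map_sub, cls_eq_zero h]
  rfl

/-- The morphism of the homotopy category given by a closed morphism of degree zero. -/
def H0.ofClosed {C : DGCat.{w, v, u} k} {X Y : C.Obj} (f : (C.Hom X Y).X 0)
    (hf : (C.Hom X Y).d 0 1 f = 0) : (⟨X⟩ : H0 C) ⟶ ⟨Y⟩ :=
  cls (C.Hom X Y) 0 ⟨f, (mem_cocycles (zero_add 1) f).2 hf⟩

lemma H0.exists_ofClosed {C : DGCat.{w, v, u} k} {X Y : H0 C} (φ : X ⟶ Y) :
    ∃ f hf, φ = H0.ofClosed (C := C) (X := X.as) (Y := Y.as) f hf := by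
  obtain ⟨f, rfl⟩ := cls_surjective φ
  exact ⟨f.1, d_cocycle (zero_add 1) f, rfl⟩

lemma HPushout.w {C : DGCat.{w, v, u} k} {X X' Y : C.Obj} {s : (C.Hom X X').X 0}
    {f : (C.Hom X Y).X 0} (P : HPushout C s f) (hs : (C.Hom X X').d 0 1 s = 0)
    (hf : (C.Hom X Y).d 0 1 f = 0) :
    H0.ofClosed s hs ≫ H0.ofClosed P.inl P.d_inl = H0.ofClosed f hf ≫ H0.ofClosed P.inr P.d_inr := by
  rw [← sub_eq_zero]
  exact (cls_eq_zero (neg_add_cancel 1) _).2 ⟨P.htpy, P.d_htpy⟩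

/-- A class of morphisms of the homotopy category is stable under homotopy pushouts. -/
def StableUnderHPushouts {C : DGCat.{w, v, u} k} (W : MorphismProperty (H0 C)) : Prop :=
  ∀ ⦃X X' Y : C.Obj⦄ ⦃s : (C.Hom X X').X 0⦄ ⦃f : (C.Hom X Y).X 0⦄ (P : HPushout C s f)
    (hs : (C.Hom X X').d 0 1 s = 0), (C.Hom X Y).d 0 1 f = 0 →
    W (H0.ofClosed s hs) → W (H0.ofClosed P.inr P.d_inr)

/-- Represent the two legs by closed morphisms: their homotopy pushout commutes in the homotopy
category (`HPushout.w`), and stability puts `inr` in `W`, so it is an Ore square. -/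
lemma exists_fraction_H0 {C : DGCat.{w, v, u} k} (hC : HasHPushouts C)
    {W : MorphismProperty (H0 C)} [W.IsMultiplicative] (hW : StableUnderHPushouts W)
    {X Y : H0 C} (φ : W.Q.obj X ⟶ W.Q.obj Y) :
    ∃ (Z : H0 C) (f : X ⟶ Z) (s : Y ⟶ Z), W s ∧ φ ≫ W.Q.map s = W.Q.map f := by
  refine exists_fraction W (fun X X' Y s f h => ?_) φ
  obtain ⟨s, hs, rfl⟩ := H0.exists_ofClosed s
  obtain ⟨f, hf, rfl⟩ := H0.exists_ofClosed f
  obtain ⟨P⟩ := hC s f hs hf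
  exact ⟨⟨P.pt⟩, H0.ofClosed P.inl P.d_inl, H0.ofClosed P.inr P.d_inr, hW P hs hf h, P.w hs hf⟩

/-! ### Elements of complexes, and stability of quasi-isomorphisms. -/

section Complexes

open CochainComplex CochainComplex.HomComplex

variable {V W U : CochainComplex (ModuleCat.{v} k) ℤ}

/-- The application of a morphism of complexes of degree `e` to elements of degree `n`. -/
def ap {e n m : ℤ} (h : n + e = m) :
    ((CdgK k).Hom V W).X e →ₗ[k] V.X n →ₗ[k] W.X m where
  toFun u := (Cochain.v (F := V) (G := W) u n m h).hom
  map_add' _ _ := rfl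
  map_smul' _ _ := rfl

lemma ap_comp {p q e a b c : ℤ} (h : p + q = e) (ha : a + p = b) (hb : b + q = c) (hc : a + e = c)
    (f : ((CdgK k).Hom V W).X p) (g : ((CdgK k).Hom W U).X q) (x : V.X a) :
    ap hc ((CdgK k).comp h f g) x = ap hb g (ap ha f x) :=
  ConcreteCategory.congr_hom (Cochain.comp_v (F := V) (G := W) (K := U) f g h a b c ha hb) x

lemma ap_id {n : ℤ} (x : V.X n) : ap (add_zero n) ((CdgK k).id V) x = x := by
  change (Cochain.ofHom (𝟙 V)).v n n (add_zero n) x = x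
  simp

lemma ap_d {e e' n n' m m' : ℤ} (he : e + 1 = e') (hn : n + 1 = n') (hm : m + 1 = m')
    (h : n + e = m) (h' : n' + e = m') (h'' : n + e' = m') (u : ((CdgK k).Hom V W).X e)
    (x : V.X n) : ap h'' (((CdgK k).Hom V W).d e e' u) x =
      W.d m m' (ap h u x) + e'.negOnePow • ap h' u (V.d n n' x) :=
  ConcreteCategory.congr_hom
    (δ_v (F := V) (G := W) e e' he u n m' h'' m n' (by omega) hn) x

lemma d_ap {u : ((CdgK k).Hom V W).X 0} (hu : ((CdgK k).Hom V W).d 0 1 u = 0) {n m : ℤ}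
    (h : n + 1 = m) (x : V.X n) :
    W.d n m (ap (add_zero n) u x) = ap (add_zero m) u (V.d n m x) := by
  have := ap_d (zero_add 1) h h (add_zero n) (add_zero m) h u x
  rw [hu, map_zero, LinearMap.zero_apply, Int.negOnePow_one, Units.neg_smul, one_smul] at this
  exact add_neg_eq_zero.1 this.symm

lemma d_ap_of_d_eq_comp {u : ((CdgK k).Hom V W).X 0} {a : ((CdgK k).Hom V U).X 1}
    {b : ((CdgK k).Hom U W).X 0}
    (hu : ((CdgK k).Hom V W).d 0 1 u = (CdgK k).comp (add_zero 1) a b) {n m : ℤ}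
    (h : n + 1 = m) (x : V.X n) :
    W.d n m (ap (add_zero n) u x) =
      ap (add_zero m) u (V.d n m x) + ap (add_zero m) b (ap h a x) := by
  have := ap_d (zero_add 1) h h (add_zero n) (add_zero m) h u x
  rw [hu, ap_comp _ h (add_zero m), Int.negOnePow_one, Units.neg_smul, one_smul] at this
  exact (eq_add_of_add_neg_eq this.symm).trans (add_comm _ _)

lemma d_ap_of_d_eq_neg_comp {u : ((CdgK k).Hom V W).X 0} {a : ((CdgK k).Hom V U).X 1}
    {b : ((CdgK k).Hom U W).X 0}
    (hu : ((CdgK k).Hom V W).d 0 1 u = - (CdgK k).comp (add_zero 1) a b) {n m : ℤ}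
    (h : n + 1 = m) (x : V.X n) :
    W.d n m (ap (add_zero n) u x) =
      ap (add_zero m) u (V.d n m x) - ap (add_zero m) b (ap h a x) := by
  rw [← map_neg] at hu
  rw [d_ap_of_d_eq_comp hu h x, map_neg, LinearMap.neg_apply, sub_eq_add_neg]

lemma d_ap_one {u : ((CdgK k).Hom V W).X 1} (hu : ((CdgK k).Hom V W).d 1 2 u = 0) {n m l : ℤ}
    (h : n + 1 = m) (h' : m + 1 = l) (x : V.X n) :
    W.d m l (ap h u x) = - ap h' u (V.d n m x) := by
  have := ap_d one_add_one_eq_two h h' h h' (by omega) u x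
  rw [hu, map_zero, LinearMap.zero_apply, Int.negOnePow_even 2 ⟨1, rfl⟩, one_smul] at this
  exact eq_neg_of_add_eq_zero_left this.symm

lemma d_ap_of_d_eq_sub {V' V'' : CochainComplex (ModuleCat.{v} k) ℤ}
    {u : ((CdgK k).Hom V W).X (-1)} {s : ((CdgK k).Hom V V').X 0} {f : ((CdgK k).Hom V V'').X 0}
    {a : ((CdgK k).Hom V' W).X 0} {b : ((CdgK k).Hom V'' W).X 0}
    (hu : ((CdgK k).Hom V W).d (-1) 0 u =
      (CdgK k).comp (add_zero 0) s a - (CdgK k).comp (add_zero 0) f b)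
    {n m l : ℤ} (h : l + 1 = n) (h' : n + 1 = m) (x : V.X n) :
    W.d l n (ap (by omega) u x) = ap (add_zero n) a (ap (add_zero n) s x) -
      ap (add_zero n) b (ap (add_zero n) f x) - ap (by omega) u (V.d n m x) := by
  have := ap_d (neg_add_cancel 1) h' h (by omega) (by omega) (add_zero n) u x
  rw [hu, map_sub, LinearMap.sub_apply, ap_comp _ (add_zero n) (add_zero n),
    ap_comp _ (add_zero n) (add_zero n), Int.negOnePow_zero, one_smul] at this
  exact eq_sub_of_add_eq this.symm

lemma ap_ap_of_comp_eq_zero {p q e a b c : ℤ} {h : p + q = e} {f : ((CdgK k).Hom V W).X p}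
    {g : ((CdgK k).Hom W U).X q} (hfg : (CdgK k).comp h f g = 0) (ha : a + p = b) (hb : b + q = c)
    (x : V.X a) : ap hb g (ap ha f x) = 0 := by
  rw [← ap_comp h ha hb (by omega), hfg, map_zero, LinearMap.zero_apply]

lemma ap_total {V₁ V₂ V₃ : CochainComplex (ModuleCat.{v} k) ℤ}
    {p₁ : ((CdgK k).Hom V V₁).X 0} {p₂ : ((CdgK k).Hom V V₂).X 0} {p₃ : ((CdgK k).Hom V V₃).X 1}
    {i₁ : ((CdgK k).Hom V₁ V).X 0} {i₂ : ((CdgK k).Hom V₂ V).X 0} {i₃ : ((CdgK k).Hom V₃ V).X (-1)}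
    (H : (CdgK k).comp (add_zero 0) p₁ i₁ + (CdgK k).comp (add_zero 0) p₂ i₂ +
      (CdgK k).comp (add_neg_cancel 1) p₃ i₃ = (CdgK k).id V) {n m : ℤ} (h : n + 1 = m)
    (z : V.X n) :
    ap (add_zero n) i₁ (ap (add_zero n) p₁ z) + ap (add_zero n) i₂ (ap (add_zero n) p₂ z) +
      ap (by omega) i₃ (ap h p₃ z) = z := by
  conv_rhs => rw [← ap_id (k := k) z, ← H]
  rw [map_add, map_add, LinearMap.add_apply, LinearMap.add_apply,
    ap_comp _ (add_zero n) (add_zero n), ap_comp _ (add_zero n) (add_zero n),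
    ap_comp _ h (by omega)]

lemma isIso_cohFunctor_map_iff {u : ((CdgK k).Hom V W).X 0} (hu : ((CdgK k).Hom V W).d 0 1 u = 0)
    (n : ℤ) : IsIso ((cohFunctor k n).map (H0.ofClosed u hu)) ↔
      (∀ x : V.X n, V.d n (n + 1) x = 0 →
        (∃ y, W.d (n - 1) n y = ap (add_zero n) u x) → ∃ y, V.d (n - 1) n y = x) ∧
      (∀ y : W.X n, W.d n (n + 1) y = 0 → ∃ x, V.d n (n + 1) x = 0 ∧
        ∃ z, W.d (n - 1) n z = ap (add_zero n) u x - y) := by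
  rw [ConcreteCategory.isIso_iff_bijective]
  have key : ∀ x : cocycles V n, ∃ h, (cohFunctor k n).map (H0.ofClosed u hu) (cls V n x) =
      cls W n ⟨ap (add_zero n) u x.1, h⟩ := fun x =>
    ⟨(cocyclesAct V W n ⟨u, (mem_cocycles (zero_add 1) u).2 hu⟩ x).2, rfl⟩
  refine and_congr ?_ ?_
  · change Function.Injective ((cohFunctor k n).map (H0.ofClosed u hu)).hom ↔ _
    rw [injective_iff_map_eq_zero]
    constructor
    · intro H x hx hy
      obtain ⟨h, e⟩ := key ⟨x, hx⟩
      exact (cls_eq_zero (sub_add_cancel n 1) ⟨x, hx⟩).1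
        (H _ (e.trans ((cls_eq_zero (sub_add_cancel n 1) _).2 hy)))
    · intro H x hx
      obtain ⟨x, rfl⟩ := cls_surjective x
      obtain ⟨h, e⟩ := key x
      exact (cls_eq_zero (sub_add_cancel n 1) x).2 (H x.1 (d_cocycle rfl x)
        ((cls_eq_zero (sub_add_cancel n 1) _).1 (e.symm.trans hx)))
  · constructor
    · intro H y hy
      obtain ⟨x, hx⟩ := H (cls W n ⟨y, hy⟩)
      obtain ⟨x, rfl⟩ := cls_surjective x
      obtain ⟨h, e⟩ := key x
      exact ⟨x.1, d_cocycle rfl x, (cls_eq_cls (sub_add_cancel n 1) _ _).1 (e.symm.trans hx)⟩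
    · intro H y
      obtain ⟨y, rfl⟩ := cls_surjective y
      obtain ⟨x, hx, hz⟩ := H y.1 (d_cocycle rfl y)
      refine ⟨cls V n ⟨x, hx⟩, ?_⟩
      obtain ⟨h, e⟩ := key ⟨x, hx⟩
      exact e.trans ((cls_eq_cls (sub_add_cancel n 1) _ _).2 hz)

namespace HPushout

variable {X X' Y : CochainComplex (ModuleCat.{v} k) ℤ} {s : ((CdgK k).Hom X X').X 0}
  {f : ((CdgK k).Hom X Y).X 0}

variable (P : HPushout (CdgK k) (X := X) (X' := X') (Y := Y) s f)

/-- The complex underlying a homotopy pushout of complexes. -/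
def cx : CochainComplex (ModuleCat.{v} k) ℤ := P.pt

variable {n m : ℤ}

/-- The action of `inl` on elements. -/
def elInl (n : ℤ) : X'.X n →ₗ[k] P.cx.X n := ap (add_zero n) P.inl

/-- The action of `inr` on elements. -/
def elInr (n : ℤ) : Y.X n →ₗ[k] P.cx.X n := ap (add_zero n) P.inr

/-- The action of `htpy` on elements. -/
def elHtpy (h : n + 1 = m) : X.X m →ₗ[k] P.cx.X n := ap (by omega) P.htpy

/-- The action of `fst` on elements. -/
def elFst (n : ℤ) : P.cx.X n →ₗ[k] X'.X n := ap (add_zero n) P.fst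

/-- The action of `snd` on elements. -/
def elSnd (n : ℤ) : P.cx.X n →ₗ[k] Y.X n := ap (add_zero n) P.snd

/-- The action of `proj` on elements. -/
def elProj (h : n + 1 = m) : P.cx.X n →ₗ[k] X.X m := ap h P.proj

lemma d_elInl (h : n + 1 = m) (x : X'.X n) :
    P.cx.d n m (P.elInl n x) = P.elInl m (X'.d n m x) := d_ap P.d_inl h x

lemma d_elHtpy {l : ℤ} (h : l + 1 = n) (h' : n + 1 = m) (x : X.X n) :
    P.cx.d l n (P.elHtpy h x) = P.elInl n (ap (add_zero n) s x) -
      P.elInr n (ap (add_zero n) f x) - P.elHtpy h' (X.d n m x) :=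
  d_ap_of_d_eq_sub P.d_htpy h h' x

lemma d_elProj {l : ℤ} (h : n + 1 = m) (h' : m + 1 = l) (z : P.cx.X n) :
    X.d m l (P.elProj h z) = - P.elProj h' (P.cx.d n m z) :=
  d_ap_one P.d_proj h h' z

lemma d_elFst (h : n + 1 = m) (z : P.cx.X n) :
    X'.d n m (P.elFst n z) = P.elFst m (P.cx.d n m z) - ap (add_zero m) s (P.elProj h z) :=
  d_ap_of_d_eq_neg_comp (W := X') P.d_fst h z

lemma d_elSnd (h : n + 1 = m) (z : P.cx.X n) :
    Y.d n m (P.elSnd n z) = P.elSnd m (P.cx.d n m z) + ap (add_zero m) f (P.elProj h z) :=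
  d_ap_of_d_eq_comp (W := Y) P.d_snd h z

lemma elSnd_elInr (y : Y.X n) : P.elSnd n (P.elInr n y) = y := by
  have := ap_comp (add_zero 0) (add_zero n) (add_zero n) (add_zero n) P.inr P.snd y
  rw [P.inr_snd] at this
  exact this.symm.trans (ap_id y)

lemma elFst_elInr (y : Y.X n) : P.elFst n (P.elInr n y) = 0 :=
  ap_ap_of_comp_eq_zero P.inr_fst (add_zero n) (add_zero n) y

lemma elProj_elInr (h : n + 1 = m) (y : Y.X n) : P.elProj h (P.elInr n y) = 0 :=
  ap_ap_of_comp_eq_zero P.inr_proj (add_zero n) h y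

lemma el_total (h : n + 1 = m) (z : P.cx.X n) :
    P.elInl n (P.elFst n z) + P.elInr n (P.elSnd n z) + P.elHtpy h (P.elProj h z) = z :=
  ap_total P.total h z

end HPushout

/-- Quasi-isomorphisms of complexes are stable under homotopy pushouts. -/
lemma cxQis_stableUnderHPushouts : StableUnderHPushouts (cxQis.{w, v} k) := by
  intro X X' Y s f P hs hf h n
  let X₀ : CochainComplex (ModuleCat.{v} k) ℤ := X
  let X₁ : CochainComplex (ModuleCat.{v} k) ℤ := X'
  let Y₀ : CochainComplex (ModuleCat.{v} k) ℤ := Y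
  have hs' := fun n => (isIso_cohFunctor_map_iff hs n).1 (h n)
  refine (isIso_cohFunctor_map_iff P.d_inr n).2 ⟨fun y hy => ?_, fun (z : P.cx.X n) hz => ?_⟩
  -- Injectivity: if `inr y = dz`, then `s (proj z)` is a boundary, so `proj z = dx` for some `x`,
  -- and `y = d (snd z - f x)`.
  · rintro ⟨z, hz⟩
    have e := sub_add_cancel n 1
    replace hz : P.cx.d (n - 1) n z = P.elInr n y := hz
    have h₁ := P.d_elProj e rfl z
    rw [hz, P.elProj_elInr, neg_zero] at h₁
    have h₂ := P.d_elFst e z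
    rw [hz, P.elFst_elInr, zero_sub] at h₂
    obtain ⟨x, hx⟩ := (hs' n).1 _ h₁ ⟨- P.elFst (n - 1) z, by rw [map_neg, h₂, neg_neg]⟩
    have h₃ := P.d_elSnd e z
    rw [hz, P.elSnd_elInr, ← hx] at h₃
    refine ⟨P.elSnd (n - 1) z - ap (add_zero (n - 1)) f x, ?_⟩
    have h₄ := d_ap hf e x
    rw [map_sub, h₃, h₄, add_sub_cancel_right]
  -- Surjectivity: for a cocycle `z`, a primitive `x` of `proj z` makes `snd z - f x` a cocycle. It
  -- maps to the class of `z` once `fst z + s x` is a boundary.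
  · have e := sub_add_cancel n 1
    replace hz : P.cx.d n (n + 1) z = 0 := hz
    have h₁ := P.d_elProj rfl rfl z
    rw [hz, map_zero, neg_zero] at h₁
    have h₂ := P.d_elFst rfl z
    rw [hz, map_zero, zero_sub] at h₂
    have h₃ := P.d_elSnd rfl z
    rw [hz, map_zero, zero_add] at h₃
    obtain ⟨x₀, hx₀⟩ : ∃ x₀ : X₀.X n, X₀.d n (n + 1) x₀ = P.elProj rfl z := by
      have := (hs' (n + 1)).1 _ h₁
      -- Injectivity in degree `n + 1` yields a primitive in degree `n + 1 - 1`.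
      rw [add_sub_cancel_right] at this
      exact this ⟨- P.elFst n z, by rw [map_neg, h₂, neg_neg]⟩
    -- The primitive `x₀` is corrected by a cocycle `x₁`, obtained from surjectivity of `s` on
    -- cohomology, so that `fst z + s (x₀ - x₁)` becomes the boundary of `-v`.
    obtain ⟨x₁, hx₁, v, hv⟩ := (hs' n).2 (P.elFst n z + ap (add_zero n) s x₀) (by
      rw [map_add, h₂, d_ap hs rfl, hx₀, neg_add_cancel])
    have hx : X₀.d n (n + 1) (x₀ - x₁) = P.elProj rfl z := by rw [map_sub, hx₀, hx₁, sub_zero]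
    refine ⟨P.elSnd n z - ap (add_zero n) f (x₀ - x₁), ?_,
      P.elHtpy e (x₀ - x₁) + P.elInl (n - 1) v, ?_⟩
    · rw [map_sub, h₃, d_ap hf rfl, hx, sub_self]
    · change P.cx.d (n - 1) n _ = P.elInr n _ - z
      refine Eq.trans ?_ (congrArg (P.elInr n _ - ·) (P.el_total rfl z))
      dsimp only
      rw [map_add, P.d_elHtpy e rfl, P.d_elInl e, hv, hx]
      simp only [map_sub, map_add]
      abel

end Complexes

lemma ap_ext {V W : CochainComplex (ModuleCat.{v} k) ℤ} {e : ℤ} {u u' : ((CdgK k).Hom V W).X e}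
    (H : ∀ (i j : ℤ) (h : i + e = j) (x : V.X i), ap h u x = ap h u' x) : u = u' :=
  CochainComplex.HomComplex.Cochain.ext (F := V) (G := W) _ _ fun i j h =>
    ModuleCat.hom_ext (LinearMap.ext fun x => H i j h x)

/-! ### The dg Yoneda lemma. -/

section Yoneda

open CochainComplex.HomComplex

variable (B : DGCat.{w, v, u} k) (b : B.Obj) (M : DGFun B.op (CdgK.{w, v} k))

/-- The complex of values of a right dg-module at an object. -/
def val (X : B.Obj) : CochainComplex (ModuleCat.{v} k) ℤ := M.obj X

/-- The action of a morphism `Y ⟶ X` of degree `e` on the degree `n` part of a right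
dg-module. -/
def act {X Y : B.Obj} {e n m : ℤ} (h : n + e = m) :
    (B.Hom Y X).X e →ₗ[k] (val B M X).X n →ₗ[k] (val B M Y).X m :=
  ap (V := val B M X) (W := val B M Y) h ∘ₗ M.map (X := X) (Y := Y) e

lemma act_comp {X Y Z : B.Obj} {p q e a c d : ℤ} (h : p + q = e) (h₁ : a + p = c)
    (h₂ : c + q = d) (h₃ : a + e = d) (f : (B.Hom Y X).X p) (g : (B.Hom Z Y).X q)
    (x : (val B M X).X a) :
    act B M h₃ (B.comp ((add_comm q p).trans h) g f) x =
      (p * q).negOnePow • act B M h₂ g (act B M h₁ f x) := by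
  have e₁ : M.map (X := X) (Y := Z) e ((p * q).negOnePow • B.comp ((add_comm q p).trans h) g f) =
      (CdgK k).comp h (M.map (X := X) (Y := Y) p f) (M.map (X := Y) (Y := Z) q g) :=
    M.map_comp h f g
  have e₂ : act B M h₃ ((p * q).negOnePow • B.comp ((add_comm q p).trans h) g f) x =
      act B M h₂ g (act B M h₁ f x) :=
    (LinearMap.congr_fun (congrArg (ap (V := val B M X) (W := val B M Z) h₃) e₁) x).trans
      (ap_comp (V := val B M X) (W := val B M Y) (U := val B M Z) h h₁ h₂ h₃
        (M.map (X := X) (Y := Y) p f) (M.map (X := Y) (Y := Z) q g) x)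
  rw [LinearMap.map_smul_of_tower, LinearMap.smul_apply] at e₂
  rw [← e₂, smul_smul, Int.units_mul_self, one_smul]

lemma act_id {X : B.Obj} {n : ℤ} (x : (val B M X).X n) :
    act B M (add_zero n) (B.id X) x = x :=
  (LinearMap.congr_fun (congrArg (ap (V := val B M X) (W := val B M X) (add_zero n))
    (M.map_id X)) x).trans (ap_id x)

lemma ap_yonedaMap {X Y : B.Obj} {i q j : ℤ} (h : i + q = j) (f : (B.Hom Y X).X q)
    (g : (B.Hom X b).X i) :
    ap (k := k) (V := B.Hom X b) (W := B.Hom Y b) h (yonedaMap B b q f) g =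
      (q * i).negOnePow • B.comp ((add_comm q i).trans h) f g := rfl

/-- The components of the morphism of dg-modules `B(-, b) ⟶ M` of degree `p` given by an element
of `M(b)`. -/
def yonedaHomApp (p : ℤ) (x : (val B M b).X p) (X : B.Obj) :
    ((CdgK k).Hom (B.Hom X b) (val B M X)).X p :=
  Cochain.mk (F := B.Hom X b) (G := val B M X) fun i _ h => ModuleCat.ofHom
    ((p * i).negOnePow • (act B M ((add_comm p i).trans h)).flip x)

lemma ap_yonedaHomApp (p : ℤ) (x : (val B M b).X p) (X : B.Obj) {i j : ℤ} (h : i + p = j)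
    (g : (B.Hom X b).X i) :
    ap h (yonedaHomApp B b M p x X) g =
      (p * i).negOnePow • act B M ((add_comm p i).trans h) g x := rfl

lemma yonedaHomApp_naturality (p : ℤ) (x : (val B M b).X p) {X Y : B.Obj} {q n : ℤ}
    (h : p + q = n) (h' : q + p = n) (f : (B.Hom Y X).X q) :
    (CdgK k).comp h (yonedaHomApp B b M p x X) (M.map (X := X) (Y := Y) q f) =
      (p * q).negOnePow • (CdgK k).comp (X := B.Hom X b) (Y := B.Hom Y b) h' (yonedaMap B b q f)
        (yonedaHomApp B b M p x Y) := by
  refine ap_ext (V := B.Hom X b) (W := val B M Y) fun i j hij g => ?_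
  have e₁ := ap_comp (V := B.Hom X b) (W := val B M X) (U := val B M Y) h
    (b := i + p) rfl (by omega) hij (yonedaHomApp B b M p x X) (M.map (X := X) (Y := Y) q f) g
  have e₂ := ap_comp (V := B.Hom X b) (W := B.Hom Y b) (U := val B M Y) h'
    (b := i + q) rfl (by omega) hij (yonedaMap B b q f) (yonedaHomApp B b M p x Y) g
  refine e₁.trans (Eq.trans ?_ (congrArg ((p * q).negOnePow • ·) e₂.symm))
  change act B M _ f (ap _ (yonedaHomApp B b M p x X) g) = _
  rw [ap_yonedaMap, LinearMap.map_smul_of_tower, ap_yonedaHomApp, ap_yonedaHomApp,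
    LinearMap.map_smul_of_tower,
    act_comp B M (rfl : i + q = i + q) (add_comm p i) (by omega) (by omega) g f x]
  simp only [smul_smul, ← Int.negOnePow_add]
  congr 1
  rw [Int.negOnePow_eq_iff]
  exact ⟨- (p * q + q * i), by ring⟩

/-- The morphism of dg-modules `B(-, b) ⟶ M` of degree `p` given by an element of `M(b)`. -/
def yonedaHom (p : ℤ) (x : (val B M b).X p) : dgNatTrans (yonedaDG B b) M p :=
  ⟨yonedaHomApp B b M p x, fun {X Y _ _} h h' f =>
    yonedaHomApp_naturality B b M p x (X := X) (Y := Y) h h' f⟩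

/-- Evaluation of morphisms of dg-modules `B(-, b) ⟶ M` at the identity of `b`. -/
def yonedaEv (p : ℤ) : dgNatTrans (yonedaDG B b) M p →ₗ[k] (val B M b).X p :=
  (ap (V := B.Hom b b) (W := val B M b) (zero_add p)).flip (B.id b) ∘ₗ
    LinearMap.proj (R := k) (φ := fun X => ((CdgK k).Hom (B.Hom X b) (val B M X)).X p) b ∘ₗ
    (dgNatTrans (yonedaDG B b) M p).subtype

lemma yonedaEv_apply (p : ℤ) (φ : dgNatTrans (yonedaDG B b) M p) :
    yonedaEv B b M p φ = ap (V := B.Hom b b) (W := val B M b) (zero_add p) (φ.1 b) (B.id b) :=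
  rfl

lemma yonedaEv_yonedaHom (p : ℤ) (x : (val B M b).X p) :
    yonedaEv B b M p (yonedaHom B b M p x) = x := by
  rw [yonedaEv_apply]
  change ap _ (yonedaHomApp B b M p x b) _ = _
  rw [ap_yonedaHomApp, act_id, mul_zero, Int.negOnePow_zero, one_smul]

/-- Naturality along `g`, evaluated at the identity of `b`, expresses the value of `φ` at `g` up to
sign as the action of `g` on the value at the identity. -/
lemma yonedaEv_injective (p : ℤ) : Function.Injective (yonedaEv B b M p) := by
  rw [injective_iff_map_eq_zero]
  intro φ hφ
  rw [yonedaEv_apply] at hφ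
  refine Subtype.ext (funext fun (X : B.Obj) => ?_)
  refine ap_ext (V := B.Hom X b) (W := val B M X) fun i j h g => ?_
  have e := φ.2 (X := b) (Y := X) (q := i) ((add_comm p i).trans h) h g
  have e₁ := ap_comp (V := B.Hom b b) (W := val B M b) (U := val B M X)
    ((add_comm p i).trans h) (zero_add p) ((add_comm p i).trans h) (zero_add j) (φ.1 b)
    (M.map (X := b) (Y := X) i g) (B.id b)
  have e₂ := ap_comp (V := B.Hom b b) (W := B.Hom X b) (U := val B M X) h (zero_add i) h
    (zero_add j) (yonedaMap B b i g) (φ.1 X) (B.id b)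
  rw [hφ, map_zero] at e₁
  rw [ap_yonedaMap, B.comp_id, mul_zero, Int.negOnePow_zero, one_smul] at e₂
  have e₃ : (0 : (val B M X).X j) = (p * i).negOnePow • ap h (φ.1 X) g :=
    e₁.symm.trans ((LinearMap.congr_fun
      (congrArg (ap (V := B.Hom b b) (W := val B M X) (zero_add j)) e) (B.id b)).trans
      (congrArg ((p * i).negOnePow • ·) e₂))
  exact (smul_eq_zero_iff_eq _).1 e₃.symm

/-- The identity is closed, so the second term of the Leibniz rule vanishes. -/
lemma yonedaEv_d {p q : ℤ} (h : p + 1 = q) (φ : dgNatTrans (yonedaDG B b) M p) :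
    yonedaEv B b M q (dgNatTransD _ _ p q φ) = (val B M b).d p q (yonedaEv B b M p φ) := by
  have := ap_d (V := B.Hom b b) (W := val B M b) h (zero_add 1) h (zero_add p)
    ((add_comm 1 p).trans h) (zero_add q) (φ.1 b) (B.id b)
  rw [B.d_id, map_zero, smul_zero, add_zero] at this
  exact this

end Yoneda

/-- The class of the identity in the zeroth cohomology of `B(-, b)`. -/
def yonedaElt (B : DGCat.{w, v, u} k) (b : B.Obj) :
    ((modH0 B).obj ⟨yonedaDG B b⟩).obj ⟨⟨b⟩⟩ :=
  cls (B.Hom b b) 0 ⟨B.id b, (mem_cocycles (zero_add 1) _).2 (B.d_id b)⟩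

/-- Representable dg-modules corepresent zeroth cohomology in the homotopy category. -/
lemma yoneda_bijective (B : DGCat.{w, v, u} k) (b : B.Obj) (N : DGFun B.op (CdgK.{w, v} k)) :
    Function.Bijective fun φ : (⟨yonedaDG B b⟩ : HoMod B) ⟶ ⟨N⟩ =>
      ((modH0 B).map φ).app ⟨⟨b⟩⟩ (yonedaElt B b) := by
  have key : ∀ f hf, ∃ h, ((modH0 B).map (H0.ofClosed (C := DGMod B) (X := yonedaDG B b)
      (Y := N) f hf)).app ⟨⟨b⟩⟩ (yonedaElt B b) =
        cls (val B N b) 0 ⟨yonedaEv B b N 0 f, h⟩ := fun f hf => by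
    refine ⟨?_, rfl⟩
    refine (mem_cocycles (zero_add 1) _).2 ((yonedaEv_d B b N (zero_add 1) f).symm.trans ?_)
    exact (congrArg (yonedaEv B b N 1) hf).trans (map_zero _)
  refine ⟨fun φ ψ hφψ => ?_, fun x => ?_⟩
  · obtain ⟨f, hf, rfl⟩ := H0.exists_ofClosed φ
    obtain ⟨g, hg, rfl⟩ := H0.exists_ofClosed ψ
    obtain ⟨hf', e⟩ := key f hf
    obtain ⟨hg', e'⟩ := key g hg
    obtain ⟨z, hz⟩ := (cls_eq_cls (neg_add_cancel 1) _ _).1 (e.symm.trans (hφψ.trans e'))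
    -- A primitive `z` of the difference of the values extends to a homotopy. Its differential is
    -- checked at the identity, by injectivity of evaluation.
    refine (cls_eq_cls (neg_add_cancel 1) _ _).2 ⟨yonedaHom B b N (-1) z, ?_⟩
    refine yonedaEv_injective B b N 0 ((yonedaEv_d B b N (neg_add_cancel 1) _).trans ?_)
    rw [yonedaEv_yonedaHom]
    exact hz.trans (map_sub (yonedaEv B b N 0) f g).symm
  · obtain ⟨x, rfl⟩ : ∃ y : cocycles (val B N b) 0, cls _ 0 y = x := cls_surjective x
    -- Closedness too is tested at the identity, where it says that `x` is a cocycle.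
    have hf : dgNatTransD _ _ 0 1 (yonedaHom B b N 0 x.1) = 0 :=
      yonedaEv_injective B b N 1 (by
        rw [yonedaEv_d B b N (zero_add 1), yonedaEv_yonedaHom, map_zero]
        exact d_cocycle (zero_add 1) x)
    obtain ⟨h, e⟩ := key (yonedaHom B b N 0 x.1) hf
    exact ⟨_, e.trans (congrArg (cls _ 0) (Subtype.ext (yonedaEv_yonedaHom B b N 0 x.1)))⟩

/-! ### The derived category of dg-modules. -/

section Derived

variable (B : DGCat.{w, v, u} k)

instance : (modQis B).IsMultiplicative where
  id_mem M b n := by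
    let G : HoMod B ⥤ ModuleCat.{v} k := (evDG B.op (CdgK k) b).H0 ⋙ cohFunctor k n
    exact inferInstanceAs (IsIso (G.map (𝟙 M)))
  comp_mem f g hf hg b n := by
    let G : HoMod B ⥤ ModuleCat.{v} k := (evDG B.op (CdgK k) b).H0 ⋙ cohFunctor k n
    have : IsIso (G.map f) := hf b n
    have : IsIso (G.map g) := hg b n
    change IsIso (G.map (f ≫ g))
    rw [G.map_comp]
    infer_instance

/-- Evaluation at `b` is a dg-functor, hence preserves homotopy pushouts, and quasi-isomorphisms are
objectwise. -/
lemma modQis_stableUnderHPushouts : StableUnderHPushouts (modQis B) := by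
  intro X X' Y s f P hs hf h b
  exact cxQis_stableUnderHPushouts (P.map (evDG B.op (CdgK k) b))
    (congrFun (congrArg Subtype.val hs) b) (congrFun (congrArg Subtype.val hf) b) (h b)

lemma hasHPushouts_DGMod : HasHPushouts (DGMod B) := hasHPushouts_funDG hasHPushouts_CdgK

lemma dMod_exists_fraction {M N : HoMod B} (φ : (modQis B).Q.obj M ⟶ (modQis B).Q.obj N) :
    ∃ (K : HoMod B) (f : M ⟶ K) (s : N ⟶ K), modQis B s ∧
      φ ≫ (modQis B).Q.map s = (modQis B).Q.map f :=
  exists_fraction_H0 (hasHPushouts_DGMod B) (modQis_stableUnderHPushouts B) φ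

/-- Representable dg-modules corepresent zeroth cohomology in the derived category. -/
lemma dMod_yoneda_bijective (b : B.Obj) (M : HoMod B) :
    Function.Bijective
      fun φ : (modQis B).Q.obj ⟨yonedaDG B b⟩ ⟶ (modQis B).Q.obj M =>
        ((dModH0 B).map φ).app ⟨⟨b⟩⟩ (yonedaElt B b) := by
  have hlift : ∀ φ : (modQis B).Q.obj ⟨yonedaDG B b⟩ ⟶ (modQis B).Q.obj M,
      ∃ f, φ = (modQis B).Q.map f := fun φ => by
    obtain ⟨K, f, s, hs, h⟩ := dMod_exists_fraction B φ
    have hs' : IsIso ((modH0 B).map s) := modH0_inverts B s hs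
    have hs'' : IsIso ((modQis B).Q.map s) := MorphismProperty.Q_inverts _ _ hs
    -- Since `s` is invertible on zeroth cohomology, the element corresponding to `f` lifts to `M`.
    -- The morphism `g` it defines satisfies `g ≫ s = f`, so the denominator disappears.
    obtain ⟨g, hg⟩ := (yoneda_bijective B b M.as).2
      ((inv ((modH0 B).map s)).app ⟨⟨b⟩⟩ (((modH0 B).map f).app ⟨⟨b⟩⟩ (yonedaElt B b)))
    have hgs : g ≫ s = f := (yoneda_bijective B b K.as).1 (by
      dsimp only at hg ⊢
      rw [Functor.map_comp, NatTrans.comp_app, ConcreteCategory.comp_apply, hg,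
        ← ConcreteCategory.comp_apply, ← NatTrans.comp_app, IsIso.inv_hom_id]
      rfl)
    exact ⟨g, by rw [← cancel_mono ((modQis B).Q.map s), h, ← Functor.map_comp, hgs]⟩
  refine ⟨fun φ ψ h => ?_, fun x => ?_⟩
  · obtain ⟨f, rfl⟩ := hlift φ
    obtain ⟨g, rfl⟩ := hlift ψ
    exact congrArg _ ((yoneda_bijective B b M.as).1 h)
  · obtain ⟨f, hf⟩ := (yoneda_bijective B b M.as).2 x
    exact ⟨(modQis B).Q.map f, hf⟩

/-- A Yoneda argument inside the representables: `ψ` is bijective on morphisms out of each of them.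
The identity of `B(-, b')` lifts to a right inverse, which is also a left inverse by injectivity on
morphisms out of `B(-, b)`. -/
lemma isIso_of_isIso_dModH0_yoneda {b b' : B.Obj}
    (ψ : (modQis B).Q.obj ⟨yonedaDG B b⟩ ⟶ (modQis B).Q.obj ⟨yonedaDG B b'⟩)
    (h : IsIso ((dModH0 B).map ψ)) : IsIso ψ := by
  have key : ∀ (c : B.Obj), Function.Bijective
      fun φ : (modQis B).Q.obj ⟨yonedaDG B c⟩ ⟶ (modQis B).Q.obj ⟨yonedaDG B b⟩ => φ ≫ ψ := by
    intro c
    have h₁ := dMod_yoneda_bijective B c ⟨yonedaDG B b⟩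
    have h₂ := dMod_yoneda_bijective B c ⟨yonedaDG B b'⟩
    have h₃ : Function.Bijective (((dModH0 B).map ψ).app ⟨⟨c⟩⟩) :=
      ConcreteCategory.bijective_of_isIso _
    refine (Function.Bijective.of_comp_iff' h₂ _).1 ?_
    convert h₃.comp h₁ using 1
    funext φ
    simp only [Function.comp_apply, Functor.map_comp, NatTrans.comp_app]
    rfl
  obtain ⟨σ, hσ⟩ := (key b').2 (𝟙 _)
  dsimp only at hσ
  exact ⟨σ, (key b).1 (by simp only [Category.assoc, hσ, Category.comp_id, Category.id_comp]), hσ⟩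

/-- Zeroth cohomology reflects isomorphisms between quasi-representable dg-modules. -/
lemma isIso_of_isIso_dModH0 {M N : DMod B} {b b' : B.Obj}
    (e : M ≅ (modQis B).Q.obj ⟨yonedaDG B b⟩) (e' : N ≅ (modQis B).Q.obj ⟨yonedaDG B b'⟩)
    (ψ : M ⟶ N) (h : IsIso ((dModH0 B).map ψ)) : IsIso ψ := by
  have : IsIso (e.inv ≫ ψ ≫ e'.hom) := isIso_of_isIso_dModH0_yoneda B _ (by
    rw [Functor.map_comp, Functor.map_comp]
    infer_instance)
  have e₁ : ψ = e.hom ≫ (e.inv ≫ ψ ≫ e'.hom) ≫ e'.inv := by simp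
  rw [e₁]
  infer_instance

/-- The `n`-th cohomology at an object `b`, on the derived category of right `B`-dg-modules. -/
def dModCoh (b : B.Obj) (n : ℤ) : DMod B ⥤ ModuleCat.{v} k :=
  Localization.Construction.lift ((evDG B.op (CdgK k) b).H0 ⋙ cohFunctor k n)
    (fun _ _ _ hf => hf b n)

/-- Cohomology in each degree and at each object factors through the localization, so the
quasi-isomorphisms are exactly the morphisms that it inverts. -/
lemma modQis_of_isIso_Q {M N : HoMod B} (f : M ⟶ N) (h : IsIso ((modQis B).Q.map f)) :
    modQis B f := fun b n =>
  inferInstanceAs (IsIso ((dModCoh B b n).map ((modQis B).Q.map f)))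

end Derived

/-! ### The derived category of bimodules. -/

section Bimodules

variable (A : DGCat.{w, v₁, u₁} k) (B : DGCat.{w, v, u} k)

instance : (bimodQis A B).IsMultiplicative where
  id_mem M a := by
    let G : HoBimod A B ⥤ HoMod B := (evDG A (DGMod B) a).H0
    change modQis B (G.map (𝟙 M))
    rw [G.map_id]
    exact (modQis B).id_mem _
  comp_mem f g hf hg a := by
    let G : HoBimod A B ⥤ HoMod B := (evDG A (DGMod B) a).H0
    change modQis B (G.map (f ≫ g))
    rw [G.map_comp]
    exact (modQis B).comp_mem _ _ (hf a) (hg a)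

lemma hasHPushouts_DGBimod : HasHPushouts (DGBimod A B) :=
  hasHPushouts_funDG (hasHPushouts_DGMod B)

lemma bimodQis_stableUnderHPushouts : StableUnderHPushouts (bimodQis A B) := by
  intro X X' Y s f P hs hf h a
  exact modQis_stableUnderHPushouts B (P.map (evDG A (DGMod B) a))
    (congrFun (congrArg Subtype.val hs) a) (congrFun (congrArg Subtype.val hf) a) (h a)

/-- The evaluation functors on the derived category of bimodules jointly reflect
isomorphisms. -/
lemma isIso_of_isIso_dEval {T T' : DBimod A B} (φ : T ⟶ T')
    (h : ∀ a, IsIso ((dEval A B a).map φ)) : IsIso φ := by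
  obtain ⟨M, rfl⟩ : ∃ M, (bimodQis A B).Q.obj M = T :=
    (Localization.Construction.objEquiv (bimodQis A B)).surjective T
  obtain ⟨N, rfl⟩ : ∃ N, (bimodQis A B).Q.obj N = T' :=
    (Localization.Construction.objEquiv (bimodQis A B)).surjective T'
  obtain ⟨K, f, s, hs, hφ⟩ := exists_fraction_H0
    (hasHPushouts_DGBimod A B) (bimodQis_stableUnderHPushouts A B) φ
  have hs' : IsIso ((bimodQis A B).Q.map s) := MorphismProperty.Q_inverts _ _ hs
  -- In `φ ≫ Q(s) = Q(f)` the left side becomes invertible after each evaluation, so each value of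
  -- `f` is inverted in the derived category of modules.
  have hf : bimodQis A B f := fun a => modQis_of_isIso_Q B _ (by
    have := h a
    have : IsIso ((dEval A B a).map ((bimodQis A B).Q.map f)) := by
      rw [← hφ, Functor.map_comp]
      infer_instance
    exact this)
  have hf' : IsIso ((bimodQis A B).Q.map f) := MorphismProperty.Q_inverts _ _ hf
  rw [← hφ] at hf'
  exact IsIso.of_isIso_comp_right φ ((bimodQis A B).Q.map s)

lemma isIso_dModH0_dEval {T T' : DBimod A B} (φ : T ⟶ T') (h : IsIso ((dBimodH0 A B).map φ))
    (a : A.Obj) : IsIso ((dModH0 B).map ((dEval A B a).map φ)) := by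
  -- The two functors agree strictly before localization, so the universal property makes them
  -- equal.
  have e : dEval A B a ⋙ dModH0 B = dBimodH0 A B ⋙ (evaluation _ _).obj ⟨a⟩ :=
    Localization.Construction.uniq _ _ rfl
  have : IsIso ((dBimodH0 A B ⋙ (evaluation _ _).obj ⟨a⟩).map φ) := by
    rw [Functor.comp_map]
    infer_instance
  rw [← e] at this
  exact this

end Bimodules

end

end DG

/-! ### Reflection of isomorphisms by `H⁰`. -/

theorem proposition3p2 {k : Type u} [Field k] (A B : DG.DGCat.{u, u, u} k) :
    (DG.quasiFunH0 A B).ReflectsIsomorphisms := by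
  refine ⟨fun {T T'} φ hφ => ?_⟩
  -- The functor `quasiFunH0` followed by `linPost` is naturally isomorphic to objectwise zeroth
  -- cohomology, so invertibility passes from the former to the latter.
  have h : IsIso ((DG.dBimodH0 A B).map φ.hom) :=
    (NatIso.isIso_map_iff (Functor.essImage.liftFunctorCompIso ((DG.IsRqr A B).ι ⋙
      DG.dBimodH0 A B) (DG.linPost A B) (DG.rqr_mem_essImage A B)) φ).1
      (inferInstanceAs (IsIso ((DG.linPost A B).map ((DG.quasiFunH0 A B).map φ))))
  have : IsIso ((DG.IsRqr A B).ι.map φ) := DG.isIso_of_isIso_dEval A B _ fun a => by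
    obtain ⟨b, ⟨e⟩⟩ := T.property a
    obtain ⟨b', ⟨e'⟩⟩ := T'.property a
    exact DG.isIso_of_isIso_dModH0 B e e' _ (DG.isIso_dModH0_dEval A B _ h a)
  exact isIso_of_reflects_iso φ (DG.IsRqr A B).ι
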